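/- Let $\mathfrak X$ be a real ordered Banach space whose positive cone $\mathfrak X_+$ is closed and generating ($\mathfrak X=\mathfrak X_+-\mathfrak X_+$) and on which the norm is additive: $\|u+v\|=\|u\|+\|v\|$ for $u,v\in\mathfrak X_+$. Let $\Psi\in\mathfrak X^\star$ be the unique functional with $\langle\Psi,u\rangle=\|u\|$ for $u\in\mathfrak X_+$. A $C_0$-semigroup $(T(t))_{t\ge0}$ on $\mathfrak X$ is called substochastic if $T(t)u\in\mathfrak X_+$ and $\|T(t)u\|\le\|u\|$ for all $u\in\mathfrak X_+$, $t\ge 0$. Let $(U(t))_{t\ge0}$ be a substochastic $C_0$-semigroup on $\mathfrak X$ with generator $(A,D(A))$, and let $B:D(A)\to\mathfrak X$ be linear and positive ($Bu\in\mathfrak X_+$ for $u\in D(A)\cap\mathfrak X_+$) with $\langle\Psi,Au+Bu\rangle\le0$ for all $u\in D(A)\cap\mathfrak X_+$. Then there is a smallest substochastic $C_0$-semigroup $(V(t))_{t\ge0}$ whose generator extends $(A+B,D(A))$; that is, $V(t)u\le S(t)u$ for all $t\ge0$, $u\in\mathfrak X_+$ and every substochastic $C_0$-semigroup $(S(t))_{t\ge0}$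 whose generator extends $(A+B,D(A))$. It satisfies the Duhamel formula $$V(t)u=U(t)u+\int_0^tV(t-s)BU(s)u\,ds,\qquad t\ge0,\ u\in D(A).$$ Moreover, put $\mathscr L^0(U)=U$ and, for $n\ge0$ and $t\ge0$, let $\mathscr L^{n+1}(U)(t)$ be the bounded operator on $\mathfrak X$ extending $$u\in D(A)\longmapsto\int_0^t\mathscr L^n(U)(t-s)BU(s)u\,ds .$$ This extension exists and is unique, and for every $n\ge0$ the map $t\mapsto\mathscr L^n(U)(t)$ is a bounded, strongly continuous map from $[0,\infty)$ into the positive bounded operators on $\mathfrak X$. For every $t\ge0$ and $u\in\mathfrak X$, $$V(t)u=\sum_{n=0}^\infty\mathscr L^n(U)(t)u,$$ where the series converges unconditionally in $\mathfrak X$. -/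

import Mathlib

open Set Filter Topology

/-- A real ordered Banach space (completeness is a separate instance) with closed generating
positive cone on which the norm is additive. -/
class AbstractStateSpace (X : Type*) [NormedAddCommGroup X] [NormedSpace ℝ X]
    [PartialOrder X] : Prop extends IsOrderedAddMonoid X, IsOrderedModule ℝ X where
  isClosed_nonneg : IsClosed {u : X | 0 ≤ u}
  generating : ∀ u : X, ∃ v w : X, 0 ≤ v ∧ 0 ≤ w ∧ u = v - w
  norm_add : ∀ u v : X, 0 ≤ u → 0 ≤ v → ‖u + v‖ = ‖u‖ + ‖v‖

namespace AbstractStateSpace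

section Psi

variable (X : Type*) [NormedAddCommGroup X] [NormedSpace ℝ X] [PartialOrder X]
  [AbstractStateSpace X]

/-- The value `‖v‖ - ‖w‖` for some decomposition `u = v - w` with `v, w ≥ 0`. -/
noncomputable def psiFun (u : X) : ℝ :=
  ‖(generating u).choose‖ - ‖(generating u).choose_spec.choose‖

variable {X}

/-- The value does not depend on the decomposition. -/
theorem psiFun_eq {u v w : X} (hv : 0 ≤ v) (hw : 0 ≤ w) (h : u = v - w) :
    psiFun X u = ‖v‖ - ‖w‖ := by
  obtain ⟨h1, h2, h3⟩ := (generating u).choose_spec.choose_spec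
  unfold psiFun
  set a := (generating u).choose
  set b := (generating u).choose_spec.choose
  have e : a + w = v + b := by
    have h4 : a - b = v - w := h3.symm.trans h
    exact sub_eq_sub_iff_add_eq_add.mp h4
  have e1 := norm_add a w h1 hw
  have e2 := norm_add v b hv h2
  rw [e] at e1
  linarith

variable (X)

/-- The positive linear functional `Ψ` that coincides with the norm on the positive cone. -/
noncomputable def psi : X →L[ℝ] ℝ :=
  LinearMap.mkContinuous
    { toFun := psiFun X
      map_add' := by
        intro x y
        obtain ⟨a, b, ha, hb, rfl⟩ := generating x
        obtain ⟨c, d, hc, hd, rfl⟩ := generating y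
        rw [psiFun_eq ha hb rfl, psiFun_eq hc hd rfl,
          psiFun_eq (add_nonneg ha hc) (add_nonneg hb hd) (by abel),
          norm_add a c ha hc, norm_add b d hb hd]
        ring
      map_smul' := by
        intro r x
        obtain ⟨a, b, ha, hb, rfl⟩ := generating x
        rw [psiFun_eq ha hb rfl]
        rcases le_total 0 r with hr | hr
        · rw [psiFun_eq (smul_nonneg hr ha) (smul_nonneg hr hb) (smul_sub r a b),
            norm_smul, norm_smul, Real.norm_of_nonneg hr]
          simp only [RingHom.id_apply, smul_eq_mul]
          ring
        · have hr' : 0 ≤ -r := neg_nonneg.mpr hr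
          rw [psiFun_eq (smul_nonneg hr' hb) (smul_nonneg hr' ha)
            (by rw [smul_sub, neg_smul, neg_smul]; abel),
            norm_smul, norm_smul, Real.norm_of_nonneg hr']
          simp only [RingHom.id_apply, smul_eq_mul]
          ring } 1 (by
        intro x
        obtain ⟨a, b, ha, hb, rfl⟩ := generating x
        change ‖psiFun X (a - b)‖ ≤ _
        rw [psiFun_eq ha hb rfl, one_mul]
        exact abs_norm_sub_norm_le a b)

/-- `⟨Ψ, u⟩ = ‖u‖` for `u ≥ 0`; since the cone is generating, this determines `Ψ`. -/
theorem psi_of_nonneg {u : X} (hu : 0 ≤ u) : psi X u = ‖u‖ := by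
  change psiFun X u = _
  rw [psiFun_eq hu le_rfl (sub_zero u).symm, norm_zero, sub_zero]

end Psi

section Semigroups

variable {X : Type*} [NormedAddCommGroup X] [NormedSpace ℝ X]

/-- `(T(t))_{t ≥ 0}` is a `C₀`-semigroup of bounded operators; values at `t < 0` are
irrelevant. -/
structure IsC0Semigroup (T : ℝ → X →L[ℝ] X) : Prop where
  zero : T 0 = ContinuousLinearMap.id ℝ X
  add : ∀ s t : ℝ, 0 ≤ s → 0 ≤ t → T (s + t) = (T s).comp (T t)
  continuousOn : ∀ u : X, ContinuousOn (fun t => T t u) (Ici 0)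

/-- The generator: `A u = lim_{t → 0+} (T(t)u - u) / t`, with domain the set of all `u` for which
the limit exists. -/
noncomputable def generator (T : ℝ → X →L[ℝ] X) : X →ₗ.[ℝ] X where
  domain :=
    { carrier := {u | ∃ v, Tendsto (fun t : ℝ => t⁻¹ • (T t u - u)) (𝓝[>] 0) (𝓝 v)}
      add_mem' := by
        rintro a b ⟨v, hv⟩ ⟨w, hw⟩
        refine ⟨v + w, (hv.add hw).congr fun t => ?_⟩
        rw [← smul_add, map_add]
        congr 1
        abel
      zero_mem' := ⟨0, by simp⟩
      smul_mem' := by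
        rintro c a ⟨v, hv⟩
        refine ⟨c • v, (hv.const_smul c).congr fun t => ?_⟩
        rw [map_smul, ← smul_sub, smul_comm] }
  toFun :=
    { toFun := fun u => Exists.choose u.2
      map_add' := by
        intro a b
        refine tendsto_nhds_unique (Exists.choose_spec (a + b).2) ?_
        refine ((Exists.choose_spec a.2).add (Exists.choose_spec b.2)).congr fun t => ?_
        rw [← smul_add, Submodule.coe_add, map_add]
        congr 1
        abel
      map_smul' := by
        intro c a
        refine tendsto_nhds_unique (Exists.choose_spec (c • a).2) ?_
        refine ((Exists.choose_spec a.2).const_smul c).congr fun t => ?_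
        rw [Submodule.coe_smul, map_smul, ← smul_sub, smul_comm] }

theorem tendsto_generator (T : ℝ → X →L[ℝ] X) (u : (generator T).domain) :
    Tendsto (fun t : ℝ => t⁻¹ • (T t u - (u : X))) (𝓝[>] 0) (𝓝 (generator T u)) :=
  Exists.choose_spec u.2

/-- The domain of the generator is invariant under the semigroup. -/
theorem IsC0Semigroup.mem_domain {T : ℝ → X →L[ℝ] X} (hT : IsC0Semigroup T) {u : X}
    (hu : u ∈ (generator T).domain) {s : ℝ} (hs : 0 ≤ s) : T s u ∈ (generator T).domain := by
  obtain ⟨v, hv⟩ := hu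
  refine ⟨T s v, (((T s).continuous.tendsto v).comp hv).congr' ?_⟩
  filter_upwards [self_mem_nhdsWithin] with t ht
  have h1 : T (t + s) u = T t (T s u) := by rw [hT.add t s (le_of_lt ht) hs]; rfl
  have h2 : T (s + t) u = T s (T t u) := by rw [hT.add s t hs (le_of_lt ht)]; rfl
  simp only [Function.comp_apply, map_smul, map_sub]
  rw [← h1, ← h2, add_comm]

/-- The operator `A + B` with domain `D(A)`. -/
noncomputable def perturbed (A : X →ₗ.[ℝ] X) (B : A.domain →ₗ[ℝ] X) : X →ₗ.[ℝ] X where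
  domain := A.domain
  toFun := A.toFun + B

open Classical in
/-- `B x` for `x` in the domain `D` of `B` (and `0` elsewhere). It is applied below only to
elements `U(s)u` with `u ∈ D(A)` and `s ≥ 0`, which lie in `D(A)`. -/
noncomputable def onDomain {D : Submodule ℝ X} (B : D →ₗ[ℝ] X) (x : X) : X :=
  if h : x ∈ D then B ⟨x, h⟩ else 0

/-- The integrand `s ↦ S(t-s) B U(s) u`. -/
noncomputable def duhamelIntegrand (U : ℝ → X →L[ℝ] X) (B : (generator U).domain →ₗ[ℝ] X)
    (S : ℝ → X →L[ℝ] X) (t : ℝ) (u : X) (s : ℝ) : X :=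
  S (t - s) (onDomain B (U s u))

open Classical in
/-- The operator `L(S)(t)`: the bounded operator on `X` which extends
`u ∈ D(A) ↦ ∫₀ᵗ S(t-s) B U(s) u ds` (and `0` if there is no such bounded extension). -/
noncomputable def duhamelOp (U : ℝ → X →L[ℝ] X) (B : (generator U).domain →ₗ[ℝ] X)
    (S : ℝ → X →L[ℝ] X) (t : ℝ) : X →L[ℝ] X :=
  if h : ∃ T : X →L[ℝ] X, ∀ u ∈ (generator U).domain,
      T u = ∫ s in (0 : ℝ)..t, duhamelIntegrand U B S t u s
  then h.choose else 0

/-- The iterates `Lⁿ(U)`, with `L⁰(U) = U`. -/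
noncomputable def dysonPhillips (U : ℝ → X →L[ℝ] X) (B : (generator U).domain →ₗ[ℝ] X)
    (n : ℕ) : ℝ → X →L[ℝ] X :=
  (duhamelOp U B)^[n] U

variable [PartialOrder X]

/-- Substochastic `C₀`-semigroup: positive, and contractive on the positive cone. -/
structure IsSubstochastic (T : ℝ → X →L[ℝ] X) : Prop extends IsC0Semigroup T where
  nonneg : ∀ t : ℝ, 0 ≤ t → ∀ u : X, 0 ≤ u → 0 ≤ T t u
  norm_le : ∀ t : ℝ, 0 ≤ t → ∀ u : X, 0 ≤ u → ‖T t u‖ ≤ ‖u‖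

/-- `V` is the smallest substochastic `C₀`-semigroup whose generator extends `(A + B, D(A))`,
`A` being the generator of `U`. -/
structure IsMinimalSemigroup (U : ℝ → X →L[ℝ] X) (B : (generator U).domain →ₗ[ℝ] X)
    (V : ℝ → X →L[ℝ] X) : Prop extends IsSubstochastic V where
  extends_perturbed : perturbed (generator U) B ≤ generator V
  le_of_extends : ∀ S : ℝ → X →L[ℝ] X, IsSubstochastic S →
    perturbed (generator U) B ≤ generator S → ∀ t : ℝ, 0 ≤ t → ∀ u : X, 0 ≤ u → V t u ≤ S t u

/-- `S` is a strongly continuous bounded map from `[0, ∞)` to the positive bounded operators. -/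
structure IsPosBoundedStronglyContinuous (S : ℝ → X →L[ℝ] X) : Prop where
  continuousOn : ∀ u : X, ContinuousOn (fun t => S t u) (Ici 0)
  bounded : ∃ C : ℝ, ∀ t : ℝ, 0 ≤ t → ‖S t‖ ≤ C
  nonneg : ∀ t : ℝ, 0 ≤ t → ∀ u : X, 0 ≤ u → 0 ≤ S t u

end Semigroups

end AbstractStateSpace

/-!
The argument is Kato's, carried out in the time domain.

For `0 ≤ u ∈ D(A)` the hypothesis reads `‖B U(s)u‖ ≤ -⟨Ψ, A U(s)u⟩`, and the right-hand side is
minus the derivative of `‖U(s)u‖`. Hence `∫₀ᵗ ‖B U(s)u‖ ds ≤ ‖u‖ - ‖U(t)u‖`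
(`IsKatoPerturbation.integral_norm_onDomain_le_sub`): whatever `B` produces has been lost by `U`.
By the open mapping theorem every `u` is a difference of positive elements with norm control
(`exists_nonneg_sub_norm_le`). Together with the boundedness of `B` relative to `A`, this gives
`∫₀ᵗ ‖B U(s)u‖ ds ≤ K ‖u‖` on all of `D(A)`, so the Duhamel operators extend to bounded operators
and the Dyson–Phillips iterates exist, are positive, bounded and strongly continuous.

The partial sums `Pₙ(t)` of the series satisfy `Pₙ₊₁(t)u = U(t)u + ∫₀ᵗ Pₙ(t-s) B U(s)u ds`. The same
mass balance shows by induction that they are contractive on the cone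
(`IsKatoPerturbation.norm_sum_dysonPhillips_le`). As the norm is additive there, the series
converges absolutely for `u ≥ 0`. Its sum `V` obeys the semigroup law by a Cauchy product
(`IsKatoPerturbation.dysonPhillips_add`), and it is strongly continuous since
`0 ≤ V(t)u - U(t)u` has norm at most `‖u‖ - ‖U(t)u‖` for `u ≥ 0`. Letting `n → ∞` in the recursion
yields the Duhamel formula, whose derivative at `t = 0` shows that the generator of `V` extends
`A + B`.

Every substochastic semigroup `S` whose generator extends `A + B` satisfies the same Duhamel
formula, by differentiating `S(t-s)U(s)u` in `s` (`IsKatoPerturbation.duhamel_of_extends`). By induction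
`Pₙ(t) ≤ S(t)` on the cone, so `V` is minimal. A minimal semigroup is unique for `t ≥ 0`, whence the
expansion holds for every minimal semigroup.
-/

open MeasureTheory

namespace AbstractStateSpace

/-! ### The positive cone -/

section Cone

variable {X : Type*} [NormedAddCommGroup X] [NormedSpace ℝ X] [PartialOrder X]
  [AbstractStateSpace X]

/-- The order is closed since the cone is. -/
instance : OrderClosedTopology X := by
  refine ⟨?_⟩
  have h : {p : X × X | p.1 ≤ p.2} = (fun p : X × X => p.2 - p.1) ⁻¹' {u : X | 0 ≤ u} := by
    ext p; simp
  rw [h]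
  exact isClosed_nonneg.preimage (continuous_snd.sub continuous_fst)

theorem norm_sum_of_nonneg {ι : Type*} (s : Finset ι) {f : ι → X} (hf : ∀ i ∈ s, 0 ≤ f i) :
    ‖∑ i ∈ s, f i‖ = ∑ i ∈ s, ‖f i‖ := by
  rw [← psi_of_nonneg X (Finset.sum_nonneg hf), map_sum]
  exact Finset.sum_congr rfl fun i hi => psi_of_nonneg X (hf i hi)

theorem norm_sub_of_le {u v : X} (hu : 0 ≤ u) (huv : u ≤ v) : ‖v - u‖ = ‖v‖ - ‖u‖ := by
  rw [← psi_of_nonneg X (sub_nonneg.2 huv), ← psi_of_nonneg X hu,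
    ← psi_of_nonneg X (hu.trans huv), map_sub]

variable (X) in
/-- The open mapping theorem, applied to the surjection `a ↦ ∑ₛ aₛ s` from `ℓ¹` over the positive
part of the unit ball onto `X`, shows that the decomposition into positive elements can be chosen
with norm control. -/
theorem exists_nonneg_sub_norm_le [CompleteSpace X] :
    ∃ K : ℝ, 0 < K ∧ ∀ u : X, ∃ v w : X, 0 ≤ v ∧ 0 ≤ w ∧ u = v - w ∧ ‖v‖ + ‖w‖ ≤ K * ‖u‖ := by
  classical
  let S := {u : X // 0 ≤ u ∧ ‖u‖ ≤ 1}
  have hl : ∀ a : lp (fun _ : S => ℝ) 1, Summable (fun s => ‖a s‖) ∧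
      (∀ s, ‖a s • (s : X)‖ ≤ ‖a s‖) ∧ ∑' s, ‖a s‖ = ‖a‖ := by
    intro a
    have h := lp.hasSum_norm (p := 1) (by simp) a
    simp only [ENNReal.toReal_one, Real.rpow_one] at h
    refine ⟨h.summable, fun s => ?_, h.tsum_eq⟩
    rw [norm_smul]
    exact mul_le_of_le_one_right (norm_nonneg _) s.2.2
  have hs : ∀ a : lp (fun _ : S => ℝ) 1, Summable (fun s => a s • (s : X)) := fun a =>
    Summable.of_norm_bounded (hl a).1 (hl a).2.1
  let Λ : lp (fun _ : S => ℝ) 1 →L[ℝ] X := LinearMap.mkContinuous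
    { toFun := fun a => ∑' s, a s • (s : X)
      map_add' := fun a b => by
        rw [← (hs a).tsum_add (hs b)]
        simp [add_smul]
      map_smul' := fun c a => by
        rw [RingHom.id_apply, ← tsum_const_smul'']
        simp [smul_smul] } 1 (fun a => by
      rw [one_mul]
      exact (tsum_of_norm_bounded (hl a).1.hasSum
        (hl a).2.1).trans_eq (hl a).2.2)
  have hΛ : ∀ a, Λ a = ∑' s, a s • (s : X) := fun a => rfl
  have hsingle : ∀ v : X, 0 ≤ v → ∃ a, Λ a = v := by
    intro v hv
    have hS : 0 ≤ ‖v‖⁻¹ • v ∧ ‖(‖v‖⁻¹ • v)‖ ≤ 1 := by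
      refine ⟨smul_nonneg (by positivity) hv, ?_⟩
      rw [norm_smul, norm_inv, norm_norm]
      exact inv_mul_le_one
    refine ⟨lp.single 1 (⟨_, hS⟩ : S) ‖v‖, ?_⟩
    rw [hΛ, tsum_eq_single (⟨_, hS⟩ : S)]
    · rw [lp.single_apply_self]
      rcases eq_or_ne v 0 with rfl | h
      · simp
      · rw [smul_smul, mul_inv_cancel₀ (norm_ne_zero_iff.2 h), one_smul]
    · intro s hs
      rw [lp.single_apply_ne _ _ _ hs, zero_smul]
  have hsurj : Function.Surjective Λ := by
    intro u
    obtain ⟨v, w, hv, hw, rfl⟩ := generating u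
    obtain ⟨a, rfl⟩ := hsingle v hv
    obtain ⟨b, rfl⟩ := hsingle w hw
    exact ⟨a - b, map_sub _ _ _⟩
  obtain ⟨C, hC, h⟩ := Λ.exists_preimage_norm_le hsurj
  refine ⟨C, hC, fun u => ?_⟩
  obtain ⟨a, rfl, ha⟩ := h u
  have hpos : ∀ f : S → ℝ, (∀ s, 0 ≤ f s) → (∀ s, f s ≤ ‖a s‖) →
      Summable (fun s => f s • (s : X)) ∧ 0 ≤ ∑' s, f s • (s : X) ∧
        ‖∑' s, f s • (s : X)‖ ≤ ∑' s, f s := by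
    intro f hf hfa
    have hf1 : Summable f := Summable.of_nonneg_of_le hf hfa (hl a).1
    have hb : ∀ s : S, ‖f s • (s : X)‖ ≤ f s := fun s => by
      rw [norm_smul, Real.norm_of_nonneg (hf s)]
      exact mul_le_of_le_one_right (hf s) s.2.2
    exact ⟨Summable.of_norm_bounded hf1 hb, tsum_nonneg fun s => smul_nonneg (hf s) s.2.1,
      tsum_of_norm_bounded hf1.hasSum hb⟩
  have hp : ∀ s, max (a s) 0 ≤ ‖a s‖ := fun s => max_le (le_abs_self _) (norm_nonneg _)
  have hn : ∀ s, max (-a s) 0 ≤ ‖a s‖ := fun s => max_le (neg_le_abs _) (norm_nonneg _)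
  obtain ⟨p1, p2, p3⟩ := hpos (fun s => max (a s) 0) (fun s => le_max_right _ _) hp
  obtain ⟨n1, n2, n3⟩ := hpos (fun s => max (-a s) 0) (fun s => le_max_right _ _) hn
  have hsp : Summable fun s => max (a s) 0 :=
    Summable.of_nonneg_of_le (fun s => le_max_right _ _) hp (hl a).1
  have hsn : Summable fun s => max (-a s) 0 :=
    Summable.of_nonneg_of_le (fun s => le_max_right _ _) hn (hl a).1
  refine ⟨_, _, p2, n2, ?_, (add_le_add p3 n3).trans ?_⟩
  · rw [hΛ, ← p1.tsum_sub n1]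
    refine tsum_congr fun s => ?_
    rw [← sub_smul]
    congr 1
    rcases le_total (a s) 0 with h | h <;> simp [h]
  · rw [← hsp.tsum_add hsn]
    refine le_trans (le_of_eq ?_) ha
    rw [← (hl a).2.2]
    refine tsum_congr fun s => ?_
    rcases le_total (a s) 0 with h | h <;> simp [h, abs_of_nonneg, abs_of_nonpos]

end Cone

/-! ### Strong convergence of bounded families -/

section Strong

variable {X : Type*} [NormedAddCommGroup X] [NormedSpace ℝ X]

/-- A bounded strongly convergent family may be evaluated along a convergent family of vectors. -/
theorem tendsto_apply_of_bounded {ι : Type*} {l : Filter ι} {S : ι → X →L[ℝ] X} {C : ℝ}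
    (hC : ∀ᶠ i in l, ‖S i‖ ≤ C) {x : ι → X} {a y : X} (hx : Tendsto x l (𝓝 a))
    (hS : Tendsto (fun i => S i a) l (𝓝 y)) : Tendsto (fun i => S i (x i)) l (𝓝 y) := by
  have h0 : Tendsto (fun i => S i (x i - a)) l (𝓝 0) := by
    refine squeeze_zero_norm' (a := fun i => C * ‖x i - a‖) ?_ ?_
    · filter_upwards [hC] with i hi
      exact (S i).le_of_opNorm_le hi _
    · simpa using ((tendsto_iff_norm_sub_tendsto_zero.1 hx).const_mul C)
  simpa using h0.add hS

theorem continuousOn_apply_of_bounded {α : Type*} [TopologicalSpace α] {s : Set α}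
    {S : α → X →L[ℝ] X} {C : ℝ} (hC : ∀ i ∈ s, ‖S i‖ ≤ C)
    (hS : ∀ u : X, ContinuousOn (fun i => S i u) s) {x : α → X} (hx : ContinuousOn x s) :
    ContinuousOn (fun i => S i (x i)) s := fun i hi =>
  tendsto_apply_of_bounded (eventually_mem_nhdsWithin.mono hC) (hx i hi) (hS (x i) i hi)

theorem continuousOn_of_dense_of_bounded {α : Type*} [TopologicalSpace α] {s : Set α}
    {S : α → X →L[ℝ] X} {C : ℝ} (hC : ∀ i ∈ s, ‖S i‖ ≤ C) {D : Set X} (hD : Dense D)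
    (hS : ∀ u ∈ D, ContinuousOn (fun i => S i u) s) (u : X) :
    ContinuousOn (fun i => S i u) s := by
  refine continuousOn_of_uniform_approx_of_continuousOn fun V hV => ?_
  obtain ⟨ε, hε, hεV⟩ := Metric.mem_uniformity_dist.1 hV
  obtain ⟨v, hv, hvD⟩ := Metric.dense_iff.1 hD u (ε / (|C| + 1)) (by positivity)
  refine ⟨fun i => S i v, hS v hvD, fun i hi => hεV ?_⟩
  rw [dist_eq_norm, ← map_sub]
  have h1 : ‖S i (u - v)‖ ≤ C * ‖u - v‖ := (S i).le_of_opNorm_le (hC i hi) _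
  have h2 : ‖u - v‖ < ε / (|C| + 1) := by rwa [← dist_eq_norm, dist_comm]
  have h3 : ‖u - v‖ * (|C| + 1) < ε := (lt_div_iff₀ (by positivity)).1 h2
  nlinarith [le_abs_self C, norm_nonneg (u - v)]

end Strong

/-! ### Right derivatives and averages -/

section RightDeriv

variable {E : Type*} [NormedAddCommGroup E] [NormedSpace ℝ E]

theorem map_add_left_nhdsGT_zero (s : ℝ) : map (fun h => s + h) (𝓝[>] 0) = 𝓝[>] s := by
  simp

theorem hasDerivWithinAt_Ioi_of_tendsto {f : ℝ → E} {s : ℝ} {v : E}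
    (h : Tendsto (fun t : ℝ => t⁻¹ • (f (s + t) - f s)) (𝓝[>] 0) (𝓝 v)) :
    HasDerivWithinAt f v (Ioi s) s := by
  rw [hasDerivWithinAt_iff_tendsto_slope' (by simp), ← map_add_left_nhdsGT_zero, tendsto_map'_iff]
  refine h.congr fun t => ?_
  simp [slope]

theorem tendsto_average_Ici [CompleteSpace E] {f : ℝ → E} {a : ℝ} (hf : ContinuousOn f (Ici a)) :
    Tendsto (fun t : ℝ => t⁻¹ • ∫ r in a..(a + t), f r) (𝓝[>] 0) (𝓝 (f a)) := by
  have hg : Continuous fun r => f (max a r) :=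
    hf.comp_continuous (by fun_prop) fun r => mem_Ici.2 (le_max_left _ _)
  have h := (hg.integral_hasStrictDerivAt a a).hasDerivAt.tendsto_slope_zero_right
  simp only [intervalIntegral.integral_same, sub_zero, max_self] at h
  refine h.congr' ?_
  filter_upwards [self_mem_nhdsWithin] with t ht
  congr 1
  refine intervalIntegral.integral_congr fun r hr => ?_
  rw [uIcc_of_le (by linarith [mem_Ioi.1 ht])] at hr
  simp only [max_eq_right hr.1]

end RightDeriv

/-! ### Strongly continuous semigroups and their generators -/

section Semigroup

variable {X : Type*} [NormedAddCommGroup X] [NormedSpace ℝ X] {T : ℝ → X →L[ℝ] X}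

theorem generator_eq_of_tendsto {u v : X}
    (h : Tendsto (fun t : ℝ => t⁻¹ • (T t u - u)) (𝓝[>] 0) (𝓝 v)) :
    ∃ hu : u ∈ (generator T).domain, generator T ⟨u, hu⟩ = v :=
  ⟨⟨v, h⟩, tendsto_nhds_unique (tendsto_generator T ⟨u, ⟨v, h⟩⟩) h⟩

namespace IsC0Semigroup

theorem apply_zero (hT : IsC0Semigroup T) (u : X) : T 0 u = u := by simp [hT.zero]

theorem apply_add (hT : IsC0Semigroup T) {s t : ℝ} (hs : 0 ≤ s) (ht : 0 ≤ t) (u : X) :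
    T (s + t) u = T s (T t u) := by simp [hT.add s t hs ht]

theorem generator_apply (hT : IsC0Semigroup T) {u : X} (hu : u ∈ (generator T).domain) {s : ℝ}
    (hs : 0 ≤ s) :
    generator T ⟨T s u, hT.mem_domain hu hs⟩ = T s (generator T ⟨u, hu⟩) := by
  obtain ⟨_, h⟩ := generator_eq_of_tendsto (T := T) (u := T s u)
    (v := T s (generator T ⟨u, hu⟩)) (by
      refine (((T s).continuous.tendsto _).comp (tendsto_generator T ⟨u, hu⟩)).congr' ?_
      filter_upwards [self_mem_nhdsWithin] with t ht
      simp only [Function.comp_apply, map_smul, map_sub]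
      rw [← hT.apply_add hs (le_of_lt ht), ← hT.apply_add (le_of_lt ht) hs, add_comm])
  exact h

theorem hasDerivWithinAt (hT : IsC0Semigroup T) {u : X} (hu : u ∈ (generator T).domain) {s : ℝ}
    (hs : 0 ≤ s) :
    HasDerivWithinAt (fun t => T t u) (T s (generator T ⟨u, hu⟩)) (Ioi s) s := by
  refine hasDerivWithinAt_Ioi_of_tendsto ?_
  refine (((T s).continuous.tendsto _).comp (tendsto_generator T ⟨u, hu⟩)).congr' ?_
  filter_upwards [self_mem_nhdsWithin] with t ht
  simp only [Function.comp_apply, map_smul, map_sub]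
  rw [← hT.apply_add hs (le_of_lt ht)]

theorem intervalIntegrable (hT : IsC0Semigroup T) (u : X) {a b : ℝ} (ha : 0 ≤ a) (hb : 0 ≤ b) :
    IntervalIntegrable (fun r => T r u) volume a b :=
  ((hT.continuousOn u).mono fun _ hr => (le_min ha hb).trans hr.1).intervalIntegrable

theorem integrableOn_exp_smul (hT : IsC0Semigroup T) {C : ℝ} (hC : ∀ t, 0 ≤ t → ‖T t‖ ≤ C)
    (f : X) : IntegrableOn (fun t => Real.exp (-t) • T t f) (Ioi 0) := by
  refine Integrable.mono' ((integrableOn_exp_neg_Ioi 0).mul_const (C * ‖f‖)) ?_ ?_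
  · refine ContinuousOn.aestronglyMeasurable ?_ measurableSet_Ioi
    exact (Real.continuous_exp.comp continuous_neg).continuousOn.smul
      ((hT.continuousOn f).mono Ioi_subset_Ici_self)
  · refine (ae_restrict_iff' measurableSet_Ioi).2 (ae_of_all _ fun t ht => ?_)
    rw [norm_smul, Real.norm_of_nonneg (Real.exp_pos _).le]
    exact mul_le_mul_of_nonneg_left ((T t).le_of_opNorm_le (hC t (le_of_lt ht)) f)
      (Real.exp_pos _).le

variable [CompleteSpace X]

/-- `∫₀ʰ T(r)u dr` lies in the domain of the generator `A` for every `u`, and `A` maps it to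
`T(h)u - u`. -/
theorem tendsto_slope_integral (hT : IsC0Semigroup T) (u : X) {h : ℝ} (hh : 0 ≤ h) :
    Tendsto (fun t : ℝ => t⁻¹ • (T t (∫ r in (0 : ℝ)..h, T r u) - ∫ r in (0 : ℝ)..h, T r u))
      (𝓝[>] 0) (𝓝 (T h u - u)) := by
  have h1 := tendsto_average_Ici ((hT.continuousOn u).mono (Ici_subset_Ici.2 hh))
  have h2 := tendsto_average_Ici (hT.continuousOn u)
  rw [hT.apply_zero] at h2
  refine (h1.sub h2).congr' ?_
  filter_upwards [self_mem_nhdsWithin] with t ht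
  have ht0 : (0 : ℝ) ≤ t := le_of_lt ht
  rw [← smul_sub, zero_add, ← (T t).intervalIntegral_comp_comm (hT.intervalIntegrable u le_rfl hh)]
  have h3 : ∫ r in (0 : ℝ)..h, T t (T r u) = ∫ r in t..(h + t), T r u := by
    have := intervalIntegral.integral_comp_add_right (a := 0) (b := h) (fun r => T r u) t
    rw [zero_add] at this
    rw [← this]
    refine intervalIntegral.integral_congr fun r hr => ?_
    rw [uIcc_of_le hh] at hr
    simp only [← hT.apply_add ht0 hr.1, add_comm r t]
  have hi := fun {a b : ℝ} (ha : 0 ≤ a) (hb : 0 ≤ b) => hT.intervalIntegrable u ha hb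
  rw [h3, ← intervalIntegral.integral_add_adjacent_intervals (hi ht0 hh)
      (hi hh (add_nonneg hh ht0)),
    ← intervalIntegral.integral_add_adjacent_intervals (hi le_rfl ht0) (hi ht0 hh)]
  congr 1
  abel

end IsC0Semigroup

/-- The average `h⁻¹ ∫₀ʰ T(r)u dr`, which smooths `u` into the domain of the generator. -/
noncomputable def average (T : ℝ → X →L[ℝ] X) (h : ℝ) (u : X) : X :=
  h⁻¹ • ∫ r in (0 : ℝ)..h, T r u

namespace IsC0Semigroup

variable [CompleteSpace X]

theorem average_mem_domain (hT : IsC0Semigroup T) {h : ℝ} (hh : 0 < h) (u : X) :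
    average T h u ∈ (generator T).domain :=
  Submodule.smul_mem _ _ (generator_eq_of_tendsto (hT.tendsto_slope_integral u hh.le)).1

theorem generator_average (hT : IsC0Semigroup T) {h : ℝ} (hh : 0 < h) (u : X) :
    generator T ⟨average T h u, hT.average_mem_domain hh u⟩ = h⁻¹ • (T h u - u) := by
  obtain ⟨h1, h2⟩ := generator_eq_of_tendsto (hT.tendsto_slope_integral u hh.le)
  rw [← h2, ← LinearPMap.map_smul]
  rfl

theorem tendsto_average (hT : IsC0Semigroup T) (u : X) :
    Tendsto (fun h => average T h u) (𝓝[>] 0) (𝓝 u) := by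
  have h := tendsto_average_Ici (hT.continuousOn u)
  simpa only [hT.apply_zero, zero_add, average] using h


theorem dense_domain (hT : IsC0Semigroup T) : Dense ((generator T).domain : Set X) := fun u =>
  mem_closure_of_tendsto (hT.tendsto_average u) <| by
    filter_upwards [self_mem_nhdsWithin] with h hh using hT.average_mem_domain hh u

end IsC0Semigroup

/-! ### The resolvent at `1` -/

/-- The resolvent `(1 - A)⁻¹ f` of the generator, as a Laplace transform. -/
noncomputable def resolventOne (T : ℝ → X →L[ℝ] X) (f : X) : X :=
  ∫ t in Ioi (0 : ℝ), Real.exp (-t) • T t f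

namespace IsC0Semigroup

variable [CompleteSpace X]

theorem apply_resolventOne (hT : IsC0Semigroup T) {C : ℝ} (hC : ∀ t, 0 ≤ t → ‖T t‖ ≤ C)
    (f : X) {h : ℝ} (hh : 0 ≤ h) :
    T h (resolventOne T f) =
      Real.exp h • (resolventOne T f - ∫ t in (0 : ℝ)..h, Real.exp (-t) • T t f) := by
  have hi := hT.integrableOn_exp_smul hC f
  have h1 : resolventOne T f - ∫ t in (0 : ℝ)..h, Real.exp (-t) • T t f =
      ∫ t in Ioi h, Real.exp (-t) • T t f := by
    rw [← intervalIntegral.integral_Ioi_sub_Ioi hi hh, resolventOne, sub_sub_cancel]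
  have h2 : ∫ t in Ioi h, Real.exp (-t) • T t f =
      ∫ t in Ioi (0 : ℝ), Real.exp (-(t + h)) • T (t + h) f := by
    have := (measurePreserving_add_right volume h).setIntegral_preimage_emb
      (measurableEmbedding_addRight h) (fun t => Real.exp (-t) • T t f) (Ioi h)
    rw [← this]
    congr 2
    ext t
    simp
  rw [h1, h2, resolventOne, ← (T h).integral_comp_comm hi, ← integral_smul]
  refine setIntegral_congr_fun measurableSet_Ioi fun t ht => ?_
  simp only [map_smul, smul_smul, ← Real.exp_add]
  rw [add_comm t h, hT.apply_add hh (le_of_lt ht)]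
  congr 2
  ring

theorem tendsto_slope_resolventOne (hT : IsC0Semigroup T) {C : ℝ}
    (hC : ∀ t, 0 ≤ t → ‖T t‖ ≤ C) (f : X) :
    Tendsto (fun h : ℝ => h⁻¹ • (T h (resolventOne T f) - resolventOne T f)) (𝓝[>] 0)
      (𝓝 (resolventOne T f - f)) := by
  have h1 : Tendsto (fun h : ℝ => h⁻¹ • (Real.exp h - 1)) (𝓝[>] 0) (𝓝 1) := by
    simpa using (Real.hasDerivAt_exp 0).tendsto_slope_zero_right
  have h2 : Tendsto (fun h : ℝ => h⁻¹ • ∫ t in (0 : ℝ)..h, Real.exp (-t) • T t f) (𝓝[>] 0)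
      (𝓝 f) := by
    have := tendsto_average_Ici (a := 0) (f := fun t => Real.exp (-t) • T t f)
      ((Real.continuous_exp.comp continuous_neg).continuousOn.smul (hT.continuousOn f))
    simpa [hT.apply_zero] using this
  have h3 : Tendsto Real.exp (𝓝[>] 0) (𝓝 1) := by
    simpa using (Real.continuous_exp.tendsto 0).mono_left nhdsWithin_le_nhds
  have h4 := (h1.smul_const (resolventOne T f)).sub (h3.smul h2)
  rw [one_smul, one_smul] at h4
  refine h4.congr' ?_
  filter_upwards [self_mem_nhdsWithin] with h hh
  rw [hT.apply_resolventOne hC f (le_of_lt hh)]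
  simp only [smul_sub, sub_smul, smul_smul, smul_eq_mul, mul_sub, mul_one]
  rw [mul_comm (Real.exp h)]
  abel

/-- `1` is not an eigenvalue of the generator of a bounded semigroup. -/
theorem eq_zero_of_generator_eq_self (hT : IsC0Semigroup T) {C : ℝ}
    (hC : ∀ t, 0 ≤ t → ‖T t‖ ≤ C) {w : X} (hw : w ∈ (generator T).domain)
    (h : generator T ⟨w, hw⟩ = w) : w = 0 := by
  have hconst : ∀ t : ℝ, 0 ≤ t → Real.exp (-t) • T t w = w := by
    intro t ht
    have := intervalIntegral.integral_eq_sub_of_hasDeriv_right (a := 0) (b := t)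
      (f := fun s => Real.exp (-s) • T s w) (f' := fun _ => 0)
      ((Real.continuous_exp.comp continuous_neg).continuousOn.smul
        ((hT.continuousOn w).mono fun s hs => by rw [uIcc_of_le ht] at hs; exact hs.1))
      (fun s hs => by
        rw [min_eq_left ht] at hs
        have h1 := (((hasDerivAt_id s).neg.exp).hasDerivWithinAt (s := Ioi s)).smul
          (hT.hasDerivWithinAt hw hs.1.le)
        refine h1.congr_deriv ?_
        rw [h]
        simp) intervalIntegrable_const
    simp only [intervalIntegral.integral_zero, neg_zero, Real.exp_zero, one_smul,
      hT.apply_zero] at this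
    exact (sub_eq_zero.1 this.symm)
  have hlim : Tendsto (fun t : ℝ => Real.exp (-t) * (C * ‖w‖)) atTop (𝓝 0) := by
    simpa using Real.tendsto_exp_neg_atTop_nhds_zero.mul_const (C * ‖w‖)
  have : ‖w‖ ≤ 0 := by
    refine ge_of_tendsto hlim ?_
    filter_upwards [eventually_ge_atTop 0] with t ht
    calc ‖w‖ = ‖Real.exp (-t) • T t w‖ := by rw [hconst t ht]
      _ ≤ _ := by
        rw [norm_smul, Real.norm_of_nonneg (Real.exp_pos _).le]
        exact mul_le_mul_of_nonneg_left ((T t).le_of_opNorm_le (hC t ht) w) (Real.exp_pos _).le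
  exact norm_le_zero_iff.1 this

end IsC0Semigroup

end Semigroup

/-! ### Linearity of the perturbation on its domain -/

section OnDomain

variable {X : Type*} [NormedAddCommGroup X] [NormedSpace ℝ X] {D : Submodule ℝ X}

theorem onDomain_of_mem (B : D →ₗ[ℝ] X) {x : X} (hx : x ∈ D) : onDomain B x = B ⟨x, hx⟩ :=
  dif_pos hx

theorem onDomain_add (B : D →ₗ[ℝ] X) {x y : X} (hx : x ∈ D) (hy : y ∈ D) :
    onDomain B (x + y) = onDomain B x + onDomain B y := by
  rw [onDomain_of_mem B hx, onDomain_of_mem B hy, onDomain_of_mem B (D.add_mem hx hy), ← map_add]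
  rfl

theorem onDomain_smul (B : D →ₗ[ℝ] X) (c : ℝ) {x : X} (hx : x ∈ D) :
    onDomain B (c • x) = c • onDomain B x := by
  rw [onDomain_of_mem B hx, onDomain_of_mem B (D.smul_mem c hx), ← map_smul]
  rfl

theorem onDomain_sub (B : D →ₗ[ℝ] X) {x y : X} (hx : x ∈ D) (hy : y ∈ D) :
    onDomain B (x - y) = onDomain B x - onDomain B y := by
  rw [onDomain_of_mem B hx, onDomain_of_mem B hy, onDomain_of_mem B (D.sub_mem hx hy), ← map_sub]
  rfl

end OnDomain

/-! ### Substochastic semigroups -/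

section Substochastic

variable {X : Type*} [NormedAddCommGroup X] [NormedSpace ℝ X] [PartialOrder X]
  {U : ℝ → X →L[ℝ] X}

theorem IsSubstochastic.norm_average_le (hU : IsSubstochastic U) {h : ℝ} (hh : 0 < h) {u : X}
    (hu : 0 ≤ u) :
    ‖average U h u‖ ≤ ‖u‖ := by
  have h1 := intervalIntegral.norm_integral_le_of_norm_le_const (a := 0) (b := h) (C := ‖u‖)
    (f := fun r => U r u) fun r hr => by
      rw [uIoc_of_le hh.le] at hr
      exact hU.norm_le r hr.1.le u hu
  rw [sub_zero, abs_of_pos hh] at h1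
  rw [average, norm_smul, norm_inv, Real.norm_of_nonneg hh.le]
  calc h⁻¹ * _ ≤ h⁻¹ * (‖u‖ * h) := mul_le_mul_of_nonneg_left h1 (by positivity)
    _ = ‖u‖ := by field_simp

variable [AbstractStateSpace X]

theorem IsSubstochastic.resolventOne_nonneg (hU : IsSubstochastic U) {f : X} (hf : 0 ≤ f) :
    0 ≤ resolventOne U f :=
  integral_nonneg_of_ae <| (ae_restrict_iff' measurableSet_Ioi).2 <| ae_of_all _ fun t ht =>
    smul_nonneg (Real.exp_pos _).le (hU.nonneg t (le_of_lt ht) f hf)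

theorem intervalIntegral_nonneg {f : ℝ → X} {a b : ℝ} (hab : a ≤ b)
    (hf : ∀ r ∈ Icc a b, 0 ≤ f r) : 0 ≤ ∫ r in a..b, f r := by
  rw [intervalIntegral.integral_of_le hab]
  exact integral_nonneg_of_ae <| (ae_restrict_iff' measurableSet_Ioc).2 <| ae_of_all _ fun r hr =>
    hf r (Ioc_subset_Icc_self hr)

theorem IsSubstochastic.average_nonneg (hU : IsSubstochastic U) {h : ℝ} (hh : 0 < h) {u : X}
    (hu : 0 ≤ u) :
    0 ≤ average U h u :=
  smul_nonneg (by positivity)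
    (intervalIntegral_nonneg hh.le fun r hr => hU.nonneg r hr.1 u hu)

variable (X) in
/-- Operators that are contractive on the cone are bounded uniformly, by the constant of the
open mapping theorem. -/
theorem exists_opNorm_le_of_le_on_cone [CompleteSpace X] :
    ∃ K : ℝ, 0 < K ∧ ∀ P : X →L[ℝ] X, (∀ u, 0 ≤ u → ‖P u‖ ≤ ‖u‖) → ‖P‖ ≤ K := by
  obtain ⟨K, hK, h⟩ := exists_nonneg_sub_norm_le X
  refine ⟨K, hK, fun P hP => P.opNorm_le_bound hK.le fun u => ?_⟩
  obtain ⟨v, w, hv, hw, rfl, hn⟩ := h u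
  rw [map_sub]
  exact (norm_sub_le _ _).trans ((add_le_add (hP v hv) (hP w hw)).trans hn)

variable [CompleteSpace X]

namespace IsSubstochastic

theorem exists_bound (hU : IsSubstochastic U) : ∃ C : ℝ, ∀ t, 0 ≤ t → ‖U t‖ ≤ C := by
  obtain ⟨K, -, h⟩ := exists_opNorm_le_of_le_on_cone X
  exact ⟨K, fun t ht => h _ (hU.norm_le t ht)⟩

/-- The positive part of the domain is dense in the cone. -/
theorem induction_nonneg (hU : IsSubstochastic U) {p : X → Prop} (hp : IsClosed {u | p u})
    (h : ∀ u ∈ (generator U).domain, 0 ≤ u → p u) {u : X} (hu : 0 ≤ u) : p u :=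
  hp.mem_of_tendsto (hU.tendsto_average u) <| by
    filter_upwards [self_mem_nhdsWithin] with t ht
    exact h _ (hU.average_mem_domain ht u) (hU.average_nonneg ht hu)

end IsSubstochastic

end Substochastic

/-! ### Kato perturbations -/

section Perturbation

variable {X : Type*} [NormedAddCommGroup X] [NormedSpace ℝ X] [PartialOrder X]
  [AbstractStateSpace X]

/-- `B` is a positive operator on the domain of the generator `A` of the substochastic semigroup
`U`, and `A + B` is dissipative on the cone: `⟨Ψ, Au + Bu⟩ ≤ 0` for `0 ≤ u ∈ D(A)`. -/
structure IsKatoPerturbation (U : ℝ → X →L[ℝ] X) (B : (generator U).domain →ₗ[ℝ] X) : Prop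
    extends IsSubstochastic U where
  perturbation_nonneg : ∀ u : (generator U).domain, 0 ≤ (u : X) → 0 ≤ B u
  psi_nonpos : ∀ u : (generator U).domain, 0 ≤ (u : X) → psi X (generator U u + B u) ≤ 0

namespace IsKatoPerturbation

variable {U : ℝ → X →L[ℝ] X} {B : (generator U).domain →ₗ[ℝ] X}

theorem norm_le_neg_psi (h : IsKatoPerturbation U B) (u : (generator U).domain)
    (hu : 0 ≤ (u : X)) : ‖B u‖ ≤ -psi X (generator U u) := by
  have h1 := h.psi_nonpos u hu
  rw [map_add, psi_of_nonneg X (h.perturbation_nonneg u hu)] at h1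
  linarith

theorem onDomain_nonneg (h : IsKatoPerturbation U B) {u : X} (hu : u ∈ (generator U).domain)
    (hu0 : 0 ≤ u) {s : ℝ} (hs : 0 ≤ s) : 0 ≤ onDomain B (U s u) := by
  rw [onDomain_of_mem B (h.mem_domain hu hs)]
  exact h.perturbation_nonneg _ (h.nonneg s hs u hu0)

variable [CompleteSpace X]

/-- `B` is bounded relative to the generator `A`. For `f ≥ 0` the element `u = (1 - A)⁻¹ f` is
positive and `‖Bu‖ ≤ -⟨Ψ, Au⟩ = ‖f‖ - ‖u‖`, so `B (1 - A)⁻¹` is bounded. -/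
theorem exists_relative_bound (h : IsKatoPerturbation U B) :
    ∃ M : ℝ, 0 ≤ M ∧ ∀ u : (generator U).domain, ‖B u‖ ≤ M * ‖(u : X) - generator U u‖ := by
  obtain ⟨C, hC⟩ := h.exists_bound
  obtain ⟨K, hK, hdec⟩ := exists_nonneg_sub_norm_le X
  have hpos : ∀ f : X, 0 ≤ f → ∃ z : (generator U).domain,
      generator U z = (z : X) - f ∧ ‖B z‖ ≤ ‖f‖ := by
    intro f hf
    obtain ⟨hz, hz2⟩ := generator_eq_of_tendsto (h.tendsto_slope_resolventOne hC f)
    have hz0 := h.resolventOne_nonneg hf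
    refine ⟨⟨_, hz⟩, hz2, (h.norm_le_neg_psi _ hz0).trans ?_⟩
    rw [hz2, map_sub, psi_of_nonneg X hf, psi_of_nonneg X hz0]
    linarith [norm_nonneg (resolventOne U f)]
  refine ⟨K, hK.le, fun u => ?_⟩
  obtain ⟨v, w, hv, hw, hvw, hn⟩ := hdec ((u : X) - generator U u)
  obtain ⟨y, hy, hy2⟩ := hpos v hv
  obtain ⟨z, hz, hz2⟩ := hpos w hw
  have hu : u = y - z := by
    have h0 : generator U (u - (y - z)) = ((u - (y - z) : (generator U).domain) : X) := by
      rw [LinearPMap.map_sub, LinearPMap.map_sub, hy, hz]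
      have : generator U u = (u : X) - (v - w) := by rw [← hvw]; abel
      rw [this]
      simp only [Submodule.coe_sub]
      abel
    have h1 := h.eq_zero_of_generator_eq_self hC (u - (y - z)).2 h0
    exact sub_eq_zero.1 (Subtype.ext h1)
  have hBu : B u = B y - B z := by rw [hu, map_sub]
  rw [hBu]
  exact (norm_sub_le _ _).trans ((add_le_add hy2 hz2).trans hn)

theorem continuousOn_onDomain (h : IsKatoPerturbation U B) {u : X}
    (hu : u ∈ (generator U).domain) : ContinuousOn (fun s => onDomain B (U s u)) (Ici 0) := by
  obtain ⟨M, -, hM⟩ := h.exists_relative_bound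
  intro s hs
  refine tendsto_iff_norm_sub_tendsto_zero.2 ?_
  have hc : ContinuousOn (fun s => U s (u - generator U ⟨u, hu⟩)) (Ici 0) := h.continuousOn _
  have h1 := (tendsto_iff_norm_sub_tendsto_zero.1 (hc s hs)).const_mul M
  rw [mul_zero] at h1
  refine squeeze_zero_norm' ?_ h1
  filter_upwards [self_mem_nhdsWithin] with r hr
  have hm := fun {s : ℝ} (hs : 0 ≤ s) => h.mem_domain hu hs
  rw [norm_norm, ← onDomain_sub B (hm hr) (hm hs), onDomain_of_mem B (sub_mem (hm hr) (hm hs))]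
  refine (hM _).trans_eq ?_
  have : generator U ⟨U r u - U s u, sub_mem (hm hr) (hm hs)⟩ =
      U r (generator U ⟨u, hu⟩) - U s (generator U ⟨u, hu⟩) := by
    rw [← h.generator_apply hu hr, ← h.generator_apply hu hs, ← LinearPMap.map_sub]
    rfl
  rw [this]
  simp only [map_sub]
  congr 2
  abel

theorem intervalIntegrable_norm (h : IsKatoPerturbation U B) {u : X}
    (hu : u ∈ (generator U).domain) {t : ℝ} (ht : 0 ≤ t) :
    IntervalIntegrable (fun s => ‖onDomain B (U s u)‖) volume 0 t :=
  ContinuousOn.intervalIntegrable <| (h.continuousOn_onDomain hu).norm.mono fun s hs => by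
    rw [uIcc_of_le ht] at hs
    exact hs.1

/-- The mass produced by `B` along an orbit is at most the mass lost by the orbit. -/
theorem integral_norm_onDomain_le_sub (h : IsKatoPerturbation U B) {u : X}
    (hu : u ∈ (generator U).domain) (hu0 : 0 ≤ u) {t : ℝ} (ht : 0 ≤ t) :
    ∫ s in (0 : ℝ)..t, ‖onDomain B (U s u)‖ ≤ ‖u‖ - ‖U t u‖ := by
  have hsub : uIcc 0 t ⊆ Ici 0 := fun s hs => by rw [uIcc_of_le ht] at hs; exact hs.1
  have hc : ContinuousOn (fun s => psi X (U s (generator U ⟨u, hu⟩))) (uIcc 0 t) :=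
    (psi X).continuous.comp_continuousOn ((h.continuousOn _).mono hsub)
  have hftc := intervalIntegral.integral_eq_sub_of_hasDeriv_right (a := 0) (b := t)
    (f := fun s => psi X (U s u)) (f' := fun s => psi X (U s (generator U ⟨u, hu⟩)))
    ((psi X).continuous.comp_continuousOn ((h.continuousOn _).mono hsub))
    (fun s hs => by
      rw [min_eq_left ht] at hs
      exact (psi X).hasFDerivAt.comp_hasDerivWithinAt s (h.hasDerivWithinAt hu hs.1.le))
    hc.intervalIntegrable
  rw [h.apply_zero, psi_of_nonneg X hu0, psi_of_nonneg X (h.nonneg t ht u hu0)] at hftc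
  calc _ ≤ ∫ s in (0 : ℝ)..t, -psi X (U s (generator U ⟨u, hu⟩)) := by
        refine intervalIntegral.integral_mono_on ht (h.intervalIntegrable_norm hu ht)
          hc.intervalIntegrable.neg fun s hs => ?_
        rw [onDomain_of_mem B (h.mem_domain hu hs.1), ← h.generator_apply hu hs.1]
        exact h.norm_le_neg_psi _ (h.nonneg s hs.1 u hu0)
    _ = _ := by rw [intervalIntegral.integral_neg, hftc]; ring

/-- Averaging a decomposition `u = v - w` into positive elements brings `v` and `w` into the
domain; the relative bound on `B` controls the error made in replacing `u` by its average. -/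
theorem exists_integral_norm_onDomain_le (h : IsKatoPerturbation U B) :
    ∃ K : ℝ, 0 ≤ K ∧ ∀ u ∈ (generator U).domain, ∀ t : ℝ, 0 ≤ t →
      ∫ s in (0 : ℝ)..t, ‖onDomain B (U s u)‖ ≤ K * ‖u‖ := by
  obtain ⟨C, hC⟩ := h.exists_bound
  obtain ⟨M, hM0, hM⟩ := h.exists_relative_bound
  obtain ⟨K, hK, hdec⟩ := exists_nonneg_sub_norm_le X
  refine ⟨K, hK.le, fun u hu t ht => ?_⟩
  obtain ⟨v, w, hv, hw, hvw, hn⟩ := hdec u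
  have hpos : ∀ x ∈ (generator U).domain, 0 ≤ x →
      ∫ s in (0 : ℝ)..t, ‖onDomain B (U s x)‖ ≤ ‖x‖ := fun x hx hx0 =>
    (h.integral_norm_onDomain_le_sub hx hx0 ht).trans (by linarith [norm_nonneg (U t x)])
  -- the deviation, in the graph norm, of the average of `u` from `u`
  let δ : ℝ → ℝ := fun ε =>
    ‖(u - average U ε u) - (generator U ⟨u, hu⟩ - ε⁻¹ • (U ε u - u))‖
  have hδ : Tendsto δ (𝓝[>] 0) (𝓝 0) := by
    have h1 := ((tendsto_const_nhds (x := u)).sub (h.tendsto_average u)).sub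
      ((tendsto_const_nhds (x := generator U ⟨u, hu⟩)).sub (tendsto_generator U ⟨u, hu⟩))
    simpa using h1.norm
  have hlim : Tendsto (fun ε => K * ‖u‖ + t * (M * (C * δ ε))) (𝓝[>] 0) (𝓝 (K * ‖u‖)) := by
    simpa using tendsto_const_nhds.add (((hδ.const_mul C).const_mul M).const_mul t)
  refine ge_of_tendsto hlim ?_
  filter_upwards [self_mem_nhdsWithin] with ε hε
  have hε0 : (0 : ℝ) < ε := hε
  have hvd := h.average_mem_domain hε0 v
  have hwd := h.average_mem_domain hε0 w
  have hud := h.average_mem_domain hε0 u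
  have hsplit : average U ε u = average U ε v - average U ε w := by
    simp only [average]
    rw [← smul_sub, ← intervalIntegral.integral_sub (h.intervalIntegrable v le_rfl hε0.le)
      (h.intervalIntegrable w le_rfl hε0.le), hvw]
    simp
  have hpt : ∀ s ∈ Icc 0 t, ‖onDomain B (U s u)‖ ≤ ‖onDomain B (U s (average U ε v))‖ +
      ‖onDomain B (U s (average U ε w))‖ + M * (C * δ ε) := by
    intro s hs
    have hm := fun {x : X} (hx : x ∈ (generator U).domain) => h.mem_domain hx hs.1
    have e1 : U s u = U s (u - average U ε u) +
        (U s (average U ε v) - U s (average U ε w)) := by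
      rw [← map_sub, ← hsplit, ← map_add, sub_add_cancel]
    rw [e1, onDomain_add B (hm (sub_mem hu hud)) (sub_mem (hm hvd) (hm hwd)),
      onDomain_sub B (hm hvd) (hm hwd)]
    have e2 : ‖onDomain B (U s (u - average U ε u))‖ ≤ M * (C * δ ε) := by
      rw [onDomain_of_mem B (hm (sub_mem hu hud))]
      refine (hM _).trans (mul_le_mul_of_nonneg_left ?_ hM0)
      rw [h.generator_apply (sub_mem hu hud) hs.1, ← map_sub]
      refine ((U s).le_of_opNorm_le (hC s hs.1) _).trans_eq ?_
      simp only [δ]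
      rw [← h.generator_average hε0 u, ← LinearPMap.map_sub]
      rfl
    have e3 := norm_add_le (onDomain B (U s (u - average U ε u)))
      (onDomain B (U s (average U ε v)) - onDomain B (U s (average U ε w)))
    have e4 := norm_sub_le (onDomain B (U s (average U ε v))) (onDomain B (U s (average U ε w)))
    linarith
  have hiv := h.intervalIntegrable_norm hvd ht
  have hiw := h.intervalIntegrable_norm hwd ht
  calc ∫ s in (0 : ℝ)..t, ‖onDomain B (U s u)‖
      ≤ ∫ s in (0 : ℝ)..t, (‖onDomain B (U s (average U ε v))‖ +
        ‖onDomain B (U s (average U ε w))‖ + M * (C * δ ε)) :=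
        intervalIntegral.integral_mono_on ht (h.intervalIntegrable_norm hu ht)
          ((hiv.add hiw).add intervalIntegrable_const) hpt
    _ = (∫ s in (0 : ℝ)..t, ‖onDomain B (U s (average U ε v))‖) +
        (∫ s in (0 : ℝ)..t, ‖onDomain B (U s (average U ε w))‖) + t * (M * (C * δ ε)) := by
        rw [intervalIntegral.integral_add (hiv.add hiw) intervalIntegrable_const,
          intervalIntegral.integral_add hiv hiw, intervalIntegral.integral_const, sub_zero,
          smul_eq_mul]
    _ ≤ K * ‖u‖ + t * (M * (C * δ ε)) := by
        have a1 := hpos _ hvd (h.average_nonneg hε0 hv)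
        have a2 := hpos _ hwd (h.average_nonneg hε0 hw)
        have a3 := h.norm_average_le hε0 hv
        have a4 := h.norm_average_le hε0 hw
        linarith

end IsKatoPerturbation

end Perturbation

/-! ### The Dyson–Phillips iterates -/

section Iterates

theorem dysonPhillips_zero {X : Type*} [NormedAddCommGroup X] [NormedSpace ℝ X]
    (U : ℝ → X →L[ℝ] X) (B : (generator U).domain →ₗ[ℝ] X) : dysonPhillips U B 0 = U := rfl

theorem dysonPhillips_succ {X : Type*} [NormedAddCommGroup X] [NormedSpace ℝ X]
    (U : ℝ → X →L[ℝ] X) (B : (generator U).domain →ₗ[ℝ] X) (n : ℕ) :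
    dysonPhillips U B (n + 1) = duhamelOp U B (dysonPhillips U B n) :=
  Function.iterate_succ_apply' _ _ _

variable {X : Type*} [NormedAddCommGroup X] [NormedSpace ℝ X] [PartialOrder X]
  [AbstractStateSpace X] [CompleteSpace X]

theorem IsSubstochastic.isPosBoundedStronglyContinuous {S : ℝ → X →L[ℝ] X}
    (hS : IsSubstochastic S) : IsPosBoundedStronglyContinuous S :=
  ⟨hS.continuousOn, hS.exists_bound, hS.nonneg⟩

namespace IsKatoPerturbation

variable {U : ℝ → X →L[ℝ] X} {B : (generator U).domain →ₗ[ℝ] X} {S : ℝ → X →L[ℝ] X}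

theorem eq_of_eqOn_domain (h : IsKatoPerturbation U B) {P Q : X →L[ℝ] X}
    (hPQ : ∀ u ∈ (generator U).domain, P u = Q u) : P = Q :=
  DFunLike.coe_injective (Continuous.ext_on h.dense_domain P.continuous Q.continuous hPQ)

theorem continuousOn_duhamelIntegrand (h : IsKatoPerturbation U B)
    (hS : IsPosBoundedStronglyContinuous S) (t : ℝ) {u : X} (hu : u ∈ (generator U).domain) :
    ContinuousOn (duhamelIntegrand U B S t u) (Icc 0 t) := by
  obtain ⟨C, hC⟩ := hS.bounded
  refine continuousOn_apply_of_bounded (S := fun s => S (t - s)) (C := C)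
    (fun s hs => hC _ (sub_nonneg.2 hs.2)) (fun v => ?_)
    ((h.continuousOn_onDomain hu).mono Icc_subset_Ici_self)
  exact (hS.continuousOn v).comp (by fun_prop) fun s hs => sub_nonneg.2 hs.2

theorem intervalIntegrable_duhamelIntegrand (h : IsKatoPerturbation U B)
    (hS : IsPosBoundedStronglyContinuous S) {t : ℝ} (ht : 0 ≤ t) {u : X}
    (hu : u ∈ (generator U).domain) :
    IntervalIntegrable (duhamelIntegrand U B S t u) volume 0 t := by
  refine ContinuousOn.intervalIntegrable ?_
  rw [uIcc_of_le ht]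
  exact h.continuousOn_duhamelIntegrand hS t hu

theorem norm_integral_duhamelIntegrand_le (h : IsKatoPerturbation U B) {C t : ℝ} (ht : 0 ≤ t)
    {u : X} (hu : u ∈ (generator U).domain)
    (hC : ∀ s ∈ Icc 0 t, ‖duhamelIntegrand U B S t u s‖ ≤ C * ‖onDomain B (U s u)‖) :
    ‖∫ s in (0 : ℝ)..t, duhamelIntegrand U B S t u s‖ ≤
      C * ∫ s in (0 : ℝ)..t, ‖onDomain B (U s u)‖ := by
  rw [← intervalIntegral.integral_const_mul]
  exact intervalIntegral.norm_integral_le_of_norm_le ht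
    (ae_of_all _ fun s hs => hC s (Ioc_subset_Icc_self hs))
    ((h.intervalIntegrable_norm hu ht).const_mul C)

/-- The integral operator has a bounded extension, with norm bounded uniformly in time. -/
theorem exists_duhamel_extension (h : IsKatoPerturbation U B)
    (hS : IsPosBoundedStronglyContinuous S) : ∃ C : ℝ, ∀ t : ℝ, 0 ≤ t →
      ∃ T : X →L[ℝ] X, ‖T‖ ≤ C ∧ ∀ u ∈ (generator U).domain,
        T u = ∫ s in (0 : ℝ)..t, duhamelIntegrand U B S t u s := by
  obtain ⟨C, hC⟩ := hS.bounded
  obtain ⟨K, hK0, hK⟩ := h.exists_integral_norm_onDomain_le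
  have hC0 : 0 ≤ C := (norm_nonneg _).trans (hC 0 le_rfl)
  refine ⟨C * K, fun t ht => ?_⟩
  have hi := fun {u : X} (hu : u ∈ (generator U).domain) =>
    h.intervalIntegrable_duhamelIntegrand hS ht hu
  let f : (generator U).domain →ₗ[ℝ] X :=
    { toFun := fun u => ∫ s in (0 : ℝ)..t, duhamelIntegrand U B S t u s
      map_add' := fun u v => by
        rw [← intervalIntegral.integral_add (hi u.2) (hi v.2)]
        refine intervalIntegral.integral_congr fun s hs => ?_
        rw [uIcc_of_le ht] at hs
        simp only [duhamelIntegrand, Submodule.coe_add, map_add,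
          onDomain_add B (h.mem_domain u.2 hs.1) (h.mem_domain v.2 hs.1)]
      map_smul' := fun c u => by
        rw [RingHom.id_apply, ← intervalIntegral.integral_smul]
        refine intervalIntegral.integral_congr fun s hs => ?_
        rw [uIcc_of_le ht] at hs
        simp only [duhamelIntegrand, Submodule.coe_smul, map_smul,
          onDomain_smul B c (h.mem_domain u.2 hs.1)] }
  have hf : ∀ u : (generator U).domain, ‖f u‖ ≤ C * K * ‖(generator U).domain.subtype u‖ := by
    intro u
    rw [mul_assoc]
    refine (h.norm_integral_duhamelIntegrand_le ht u.2 fun s hs => ?_).trans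
      (mul_le_mul_of_nonneg_left (hK u u.2 t ht) hC0)
    exact (S (t - s)).le_of_opNorm_le (hC _ (sub_nonneg.2 hs.2)) _
  have hd : DenseRange (generator U).domain.subtype := by
    simpa [DenseRange] using h.dense_domain
  refine ⟨f.extendOfNorm (generator U).domain.subtype,
    LinearMap.opNorm_extendOfNorm_le hd (mul_nonneg hC0 hK0) hf, fun u hu => ?_⟩
  exact LinearMap.extendOfNorm_eq hd ⟨_, hf⟩ ⟨u, hu⟩

theorem duhamelOp_apply (h : IsKatoPerturbation U B) (hS : IsPosBoundedStronglyContinuous S)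
    {t : ℝ} (ht : 0 ≤ t) {u : X} (hu : u ∈ (generator U).domain) :
    duhamelOp U B S t u = ∫ s in (0 : ℝ)..t, duhamelIntegrand U B S t u s := by
  have hex : ∃ T : X →L[ℝ] X, ∀ u ∈ (generator U).domain,
      T u = ∫ s in (0 : ℝ)..t, duhamelIntegrand U B S t u s := by
    obtain ⟨C, hC⟩ := h.exists_duhamel_extension hS
    obtain ⟨T, -, hT⟩ := hC t ht
    exact ⟨T, hT⟩
  rw [duhamelOp, dif_pos hex]
  exact hex.choose_spec u hu

theorem continuousOn_integral_duhamelIntegrand (h : IsKatoPerturbation U B)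
    (hS : IsPosBoundedStronglyContinuous S) {u : X} (hu : u ∈ (generator U).domain) :
    ContinuousOn (fun t => ∫ s in (0 : ℝ)..t, duhamelIntegrand U B S t u s) (Ici 0) := by
  obtain ⟨C, hC⟩ := hS.bounded
  -- the integrand, extended continuously to the whole plane
  let F : ℝ → ℝ → X := fun t s => S (max (t - s) 0) (onDomain B (U (max s 0) u))
  have hF : Continuous (Function.uncurry F) := by
    rw [← continuousOn_univ]
    refine continuousOn_apply_of_bounded (S := fun p : ℝ × ℝ => S (max (p.1 - p.2) 0)) (C := C)
      (fun p _ => hC _ (le_max_right _ _)) (fun v => ?_) ?_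
    · exact ((hS.continuousOn v).comp_continuous (by fun_prop)
        fun p => mem_Ici.2 (le_max_right _ _)).continuousOn
    · exact ((h.continuousOn_onDomain hu).comp_continuous
        (f := fun p : ℝ × ℝ => max p.2 0) (by fun_prop)
        fun p => mem_Ici.2 (le_max_right _ _)).continuousOn
  have hc := intervalIntegral.continuous_parametric_intervalIntegral_of_continuous
    (μ := volume) (a₀ := 0) hF continuous_id
  refine hc.continuousOn.congr fun t ht => ?_
  refine intervalIntegral.integral_congr fun s hs => ?_
  rw [uIcc_of_le ht] at hs
  simp only [F, duhamelIntegrand, max_eq_left (sub_nonneg.2 hs.2), max_eq_left hs.1]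

theorem isPosBoundedStronglyContinuous_duhamelOp (h : IsKatoPerturbation U B)
    (hS : IsPosBoundedStronglyContinuous S) :
    IsPosBoundedStronglyContinuous (duhamelOp U B S) := by
  have hbd : ∃ C : ℝ, ∀ t : ℝ, 0 ≤ t → ‖duhamelOp U B S t‖ ≤ C := by
    obtain ⟨C, hC⟩ := h.exists_duhamel_extension hS
    refine ⟨C, fun t ht => ?_⟩
    obtain ⟨T, hT, hT2⟩ := hC t ht
    rwa [h.eq_of_eqOn_domain fun u hu => (h.duhamelOp_apply hS ht hu).trans (hT2 u hu).symm]
  refine ⟨?_, hbd, fun t ht u hu => ?_⟩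
  · obtain ⟨C, hC⟩ := hbd
    exact continuousOn_of_dense_of_bounded hC h.dense_domain fun u hu =>
      (h.continuousOn_integral_duhamelIntegrand hS hu).congr fun t ht => h.duhamelOp_apply hS ht hu
  · refine h.induction_nonneg (p := fun u => 0 ≤ duhamelOp U B S t u)
      (isClosed_le continuous_const (duhamelOp U B S t).continuous) (fun u hu hu0 => ?_) hu
    rw [h.duhamelOp_apply hS ht hu]
    exact intervalIntegral_nonneg ht fun s hs =>
      hS.nonneg _ (sub_nonneg.2 hs.2) _ (h.onDomain_nonneg hu hu0 hs.1)

theorem isPosBoundedStronglyContinuous_dysonPhillips (h : IsKatoPerturbation U B) (n : ℕ) :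
    IsPosBoundedStronglyContinuous (dysonPhillips U B n) := by
  induction n with
  | zero => exact h.isPosBoundedStronglyContinuous
  | succ n ih =>
    rw [dysonPhillips_succ]
    exact h.isPosBoundedStronglyContinuous_duhamelOp ih

theorem dysonPhillips_succ_apply (h : IsKatoPerturbation U B) (n : ℕ) {t : ℝ} (ht : 0 ≤ t)
    {u : X} (hu : u ∈ (generator U).domain) :
    dysonPhillips U B (n + 1) t u =
      ∫ s in (0 : ℝ)..t, duhamelIntegrand U B (dysonPhillips U B n) t u s := by
  rw [dysonPhillips_succ]
  exact h.duhamelOp_apply (h.isPosBoundedStronglyContinuous_dysonPhillips n) ht hu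

/-- The Cauchy product identity behind the semigroup law of the Dyson–Phillips series. It follows
by splitting the integral over `[0, s + t]` at `s`: past `s` the factor `U(r)` is `U(r - s) U(s)`,
and before `s` the identity for `n` applies. -/
theorem dysonPhillips_add (h : IsKatoPerturbation U B) (n : ℕ) :
    ∀ {s t : ℝ}, 0 ≤ s → 0 ≤ t → dysonPhillips U B n (t + s) =
      ∑ p ∈ Finset.HasAntidiagonal.antidiagonal n,
        (dysonPhillips U B p.2 t).comp (dysonPhillips U B p.1 s) := by
  induction n with
  | zero =>
    intro s t hs ht
    simp [dysonPhillips_zero, h.add t s ht hs]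
  | succ n ih =>
    intro s t hs ht
    refine h.eq_of_eqOn_domain fun u hu => ?_
    have hn := h.isPosBoundedStronglyContinuous_dysonPhillips
    have hst : s ≤ t + s := by linarith
    have hi := h.continuousOn_duhamelIntegrand (hn n) (t + s) hu
    have hi1 : IntervalIntegrable (duhamelIntegrand U B (dysonPhillips U B n) (t + s) u)
        volume 0 s := by
      refine (hi.mono ?_).intervalIntegrable
      rw [uIcc_of_le hs]
      exact Icc_subset_Icc_right hst
    have hi2 : IntervalIntegrable (duhamelIntegrand U B (dysonPhillips U B n) (t + s) u)
        volume s (t + s) := by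
      refine (hi.mono ?_).intervalIntegrable
      rw [uIcc_of_le hst]
      exact Icc_subset_Icc_left hs
    have h1 : ∫ r in (0 : ℝ)..s, duhamelIntegrand U B (dysonPhillips U B n) (t + s) u r =
        ∑ p ∈ Finset.HasAntidiagonal.antidiagonal n,
          dysonPhillips U B p.2 t (dysonPhillips U B (p.1 + 1) s u) := by
      have e1 : ∫ r in (0 : ℝ)..s, duhamelIntegrand U B (dysonPhillips U B n) (t + s) u r =
          ∫ r in (0 : ℝ)..s, ∑ p ∈ Finset.HasAntidiagonal.antidiagonal n,
            dysonPhillips U B p.2 t (duhamelIntegrand U B (dysonPhillips U B p.1) s u r) := by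
        refine intervalIntegral.integral_congr fun r hr => ?_
        rw [uIcc_of_le hs] at hr
        simp only [duhamelIntegrand]
        rw [add_sub_assoc, ih (sub_nonneg.2 hr.2) ht]
        simp
      rw [e1, intervalIntegral.integral_finsetSum]
      · refine Finset.sum_congr rfl fun p _ => ?_
        rw [h.dysonPhillips_succ_apply p.1 hs hu,
          ← (dysonPhillips U B p.2 t).intervalIntegral_comp_comm
            (h.intervalIntegrable_duhamelIntegrand (hn p.1) hs hu)]
      · intro p _
        refine ContinuousOn.intervalIntegrable ?_
        rw [uIcc_of_le hs]
        exact (dysonPhillips U B p.2 t).continuous.comp_continuousOn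
          (h.continuousOn_duhamelIntegrand (hn p.1) s hu)
    have h2 : ∫ r in s..(t + s), duhamelIntegrand U B (dysonPhillips U B n) (t + s) u r =
        dysonPhillips U B (n + 1) t (U s u) := by
      rw [h.dysonPhillips_succ_apply n ht (h.mem_domain hu hs)]
      have := intervalIntegral.integral_comp_add_right (a := 0) (b := t)
        (duhamelIntegrand U B (dysonPhillips U B n) (t + s) u) s
      rw [zero_add] at this
      rw [← this]
      refine intervalIntegral.integral_congr fun r hr => ?_
      rw [uIcc_of_le ht] at hr
      simp only [duhamelIntegrand]
      rw [h.apply_add hr.1 hs, add_sub_add_right_eq_sub]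
    rw [h.dysonPhillips_succ_apply n (add_nonneg ht hs) hu,
      ← intervalIntegral.integral_add_adjacent_intervals hi1 hi2, h1, h2,
      Finset.Nat.sum_antidiagonal_succ]
    simp only [add_apply, sum_apply,
      ContinuousLinearMap.comp_apply, dysonPhillips_zero]
    rw [add_comm]

end IsKatoPerturbation

end Iterates

namespace IsKatoPerturbation

variable {X : Type*} [NormedAddCommGroup X] [NormedSpace ℝ X] [PartialOrder X]
  [AbstractStateSpace X] [CompleteSpace X]
  {U : ℝ → X →L[ℝ] X} {B : (generator U).domain →ₗ[ℝ] X}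

/-! ### Convergence of the Dyson–Phillips series -/

theorem sum_dysonPhillips_succ_apply (h : IsKatoPerturbation U B) (n : ℕ) {t : ℝ} (ht : 0 ≤ t)
    {u : X} (hu : u ∈ (generator U).domain) :
    ∑ k ∈ Finset.range (n + 1), dysonPhillips U B k t u = U t u + ∫ s in (0 : ℝ)..t,
      ∑ k ∈ Finset.range n, duhamelIntegrand U B (dysonPhillips U B k) t u s := by
  rw [Finset.sum_range_succ', intervalIntegral.integral_finsetSum fun k _ =>
    h.intervalIntegrable_duhamelIntegrand (h.isPosBoundedStronglyContinuous_dysonPhillips k) ht hu,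
    add_comm, dysonPhillips_zero]
  congr 1
  exact Finset.sum_congr rfl fun k _ => h.dysonPhillips_succ_apply k ht hu

/-- The partial sums are contractive on the cone: in the Duhamel recursion the mass of the integral
term is at most the mass which `U` has lost. -/
theorem norm_sum_dysonPhillips_le (h : IsKatoPerturbation U B) (n : ℕ) :
    ∀ {t : ℝ}, 0 ≤ t → ∀ {u : X}, 0 ≤ u →
      ‖∑ k ∈ Finset.range n, dysonPhillips U B k t u‖ ≤ ‖u‖ := by
  induction n with
  | zero => intro t _ u _; simp
  | succ n ih =>
    intro t ht u hu0
    have hc : Continuous fun u => ‖∑ k ∈ Finset.range (n + 1), dysonPhillips U B k t u‖ := by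
      fun_prop
    refine h.induction_nonneg (isClosed_le hc continuous_norm) (fun u hu hu0 => ?_) hu0
    rw [h.sum_dysonPhillips_succ_apply n ht hu]
    have h1 : ‖∫ s in (0 : ℝ)..t,
        ∑ k ∈ Finset.range n, duhamelIntegrand U B (dysonPhillips U B k) t u s‖ ≤
        ∫ s in (0 : ℝ)..t, ‖onDomain B (U s u)‖ :=
      intervalIntegral.norm_integral_le_of_norm_le ht
        (ae_of_all _ fun s hs => ih (sub_nonneg.2 hs.2) (h.onDomain_nonneg hu hu0 hs.1.le))
        (h.intervalIntegrable_norm hu ht)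
    have h2 := h.integral_norm_onDomain_le_sub hu hu0 ht
    exact (norm_add_le _ _).trans (by linarith)

theorem summable_norm_dysonPhillips (h : IsKatoPerturbation U B) {t : ℝ} (ht : 0 ≤ t) {u : X}
    (hu : 0 ≤ u) : Summable (fun n => ‖dysonPhillips U B n t u‖) ∧
      ∑' n, ‖dysonPhillips U B n t u‖ ≤ ‖u‖ := by
  have hb : ∀ n, ∑ k ∈ Finset.range n, ‖dysonPhillips U B k t u‖ ≤ ‖u‖ := fun n => by
    rw [← norm_sum_of_nonneg _ fun k _ =>
      (h.isPosBoundedStronglyContinuous_dysonPhillips k).nonneg t ht u hu]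
    exact h.norm_sum_dysonPhillips_le n ht hu
  exact ⟨summable_of_sum_range_le (fun _ => norm_nonneg _) hb,
    Real.tsum_le_of_sum_range_le (fun _ => norm_nonneg _) hb⟩

theorem summable_dysonPhillips (h : IsKatoPerturbation U B) {t : ℝ} (ht : 0 ≤ t) (u : X) :
    Summable fun n => dysonPhillips U B n t u := by
  obtain ⟨v, w, hv, hw, rfl⟩ := generating u
  simpa only [map_sub] using (h.summable_norm_dysonPhillips ht hv).1.of_norm.sub
    (h.summable_norm_dysonPhillips ht hw).1.of_norm

variable (U B) in
theorem exists_hasSum_dysonPhillips (h : IsKatoPerturbation U B) :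
    ∃ V : ℝ → X →L[ℝ] X, ∀ t, 0 ≤ t → ∀ u, HasSum (fun n => dysonPhillips U B n t u) (V t u) := by
  have : ∀ t : ℝ, ∃ P : X →L[ℝ] X, 0 ≤ t →
      ∀ u, HasSum (fun n => dysonPhillips U B n t u) (P u) := by
    intro t
    by_cases ht : 0 ≤ t
    · have hlim : Tendsto (fun n x => (∑ k ∈ Finset.range n, dysonPhillips U B k t) x) atTop
          (𝓝 fun x => ∑' k, dysonPhillips U B k t x) := by
        refine tendsto_pi_nhds.2 fun x => ?_
        simpa only [sum_apply] using
          (h.summable_dysonPhillips ht x).hasSum.tendsto_sum_nat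
      exact ⟨continuousLinearMapOfTendsto _ hlim, fun _ u => (h.summable_dysonPhillips ht u).hasSum⟩
    · exact ⟨0, fun h0 => absurd h0 ht⟩
  choose V hV using this
  exact ⟨V, hV⟩

/-! ### The sum of the series is a substochastic semigroup -/

section Sum

variable {V : ℝ → X →L[ℝ] X}

theorem sum_nonneg (h : IsKatoPerturbation U B)
    (hV : ∀ t, 0 ≤ t → ∀ u, HasSum (fun n => dysonPhillips U B n t u) (V t u))
    {t : ℝ} (ht : 0 ≤ t) {u : X} (hu : 0 ≤ u) : 0 ≤ V t u :=
  (hV t ht u).nonneg fun n => (h.isPosBoundedStronglyContinuous_dysonPhillips n).nonneg t ht u hu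

theorem norm_sum_le (h : IsKatoPerturbation U B)
    (hV : ∀ t, 0 ≤ t → ∀ u, HasSum (fun n => dysonPhillips U B n t u) (V t u))
    {t : ℝ} (ht : 0 ≤ t) {u : X} (hu : 0 ≤ u) : ‖V t u‖ ≤ ‖u‖ :=
  le_of_tendsto (hV t ht u).tendsto_sum_nat.norm <| Eventually.of_forall fun n =>
    h.norm_sum_dysonPhillips_le n ht hu

theorem sum_add (h : IsKatoPerturbation U B)
    (hV : ∀ t, 0 ≤ t → ∀ u, HasSum (fun n => dysonPhillips U B n t u) (V t u))
    {s t : ℝ} (ht : 0 ≤ t) (hs : 0 ≤ s) : V (t + s) = (V t).comp (V s) := by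
  have hpos : ∀ u : X, 0 ≤ u → V (t + s) u = V t (V s u) := by
    intro u hu
    have hn := fun n => (h.isPosBoundedStronglyContinuous_dysonPhillips n).nonneg
    let F : ℕ × ℕ → X := fun p => dysonPhillips U B p.2 t (dysonPhillips U B p.1 s u)
    have hF : Summable F := by
      refine Summable.of_norm ((summable_prod_of_nonneg fun _ => norm_nonneg _).2 ⟨fun l =>
        (h.summable_norm_dysonPhillips ht (hn l s hs u hu)).1, ?_⟩)
      exact Summable.of_nonneg_of_le (fun l => tsum_nonneg fun _ => norm_nonneg _)
        (fun l => (h.summable_norm_dysonPhillips ht (hn l s hs u hu)).2)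
        (h.summable_norm_dysonPhillips hs hu).1
    have h1 : HasSum (fun l => V t (dysonPhillips U B l s u)) (∑' p, F p) :=
      hF.hasSum.prod_fiberwise fun l => hV t ht _
    have h2 : HasSum (fun l => V t (dysonPhillips U B l s u)) (V t (V s u)) :=
      (V t).hasSum (hV s hs u)
    have h3 := (Finset.HasAntidiagonal.sigmaAntidiagonalEquivProd.hasSum_iff.2 hF.hasSum).sigma
      fun n => hasSum_fintype _
    have h4 : HasSum (fun n => dysonPhillips U B n (t + s) u) (∑' p, F p) := by
      convert h3 using 2 with n
      rw [h.dysonPhillips_add n hs ht, sum_apply,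
        ← Finset.sum_coe_sort]
      rfl
    rw [(hV _ (add_nonneg ht hs) u).unique h4, h2.unique h1]
  ext u
  obtain ⟨v, w, hv, hw, rfl⟩ := generating u
  simp only [map_sub, hpos v hv, hpos w hw, ContinuousLinearMap.comp_apply]

/-- The sum dominates `U`, so it loses less mass, and `‖V(t)u - U(t)u‖ ≤ ‖u‖ - ‖U(t)u‖`. -/
theorem norm_sum_sub_le (h : IsKatoPerturbation U B)
    (hV : ∀ t, 0 ≤ t → ∀ u, HasSum (fun n => dysonPhillips U B n t u) (V t u))
    {t : ℝ} (ht : 0 ≤ t) {u : X} (hu : 0 ≤ u) : ‖V t u - U t u‖ ≤ ‖u‖ - ‖U t u‖ := by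
  have hle : U t u ≤ V t u :=
    le_hasSum (hV t ht u) 0 fun n _ =>
      (h.isPosBoundedStronglyContinuous_dysonPhillips n).nonneg t ht u hu
  rw [norm_sub_of_le (h.nonneg t ht u hu) hle]
  linarith [h.norm_sum_le hV ht hu]

theorem tendsto_sum_zero (h : IsKatoPerturbation U B)
    (hV : ∀ t, 0 ≤ t → ∀ u, HasSum (fun n => dysonPhillips U B n t u) (V t u)) (u : X) :
    Tendsto (fun t => V t u) (𝓝[≥] 0) (𝓝 u) := by
  have hpos : ∀ u : X, 0 ≤ u → Tendsto (fun t => V t u) (𝓝[≥] 0) (𝓝 u) := by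
    intro u hu
    have hU : Tendsto (fun t => U t u) (𝓝[≥] 0) (𝓝 u) := by
      have h0 := h.continuousOn u 0 self_mem_Ici
      rwa [ContinuousWithinAt, h.apply_zero] at h0
    have h0 : Tendsto (fun t => V t u - U t u) (𝓝[≥] 0) (𝓝 0) := by
      refine squeeze_zero_norm' (a := fun t => ‖u‖ - ‖U t u‖) ?_ ?_
      · filter_upwards [self_mem_nhdsWithin] with t ht using h.norm_sum_sub_le hV ht hu
      · simpa using (tendsto_const_nhds (x := ‖u‖)).sub hU.norm
    simpa using h0.add hU
  obtain ⟨v, w, hv, hw, rfl⟩ := generating u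
  simpa only [map_sub] using (hpos v hv).sub (hpos w hw)

theorem isSubstochastic_sum (h : IsKatoPerturbation U B)
    (hV : ∀ t, 0 ≤ t → ∀ u, HasSum (fun n => dysonPhillips U B n t u) (V t u)) :
    IsSubstochastic V := by
  have h0 : ∀ u, V 0 u = u := fun u => tendsto_nhds_unique
    (tendsto_pure_nhds (fun t => V t u) 0)
    ((h.tendsto_sum_zero hV u).mono_left (pure_le_nhdsWithin self_mem_Ici))
  obtain ⟨K, hK0, hK⟩ := exists_opNorm_le_of_le_on_cone X
  have hb : ∀ t, 0 ≤ t → ‖V t‖ ≤ K := fun t ht => hK _ fun u hu => h.norm_sum_le hV ht hu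
  refine ⟨⟨ContinuousLinearMap.ext h0, fun s t hs ht => h.sum_add hV hs ht, fun u s hs => ?_⟩,
    fun t ht u hu => h.sum_nonneg hV ht hu, fun t ht u hu => h.norm_sum_le hV ht hu⟩
  -- for `s ≤ t` the difference `V(t)u - V(s)u` is `V(s)(V(t - s)u - u)`
  have hle : ∀ s t, 0 ≤ s → s ≤ t → ‖V t u - V s u‖ ≤ K * ‖V (t - s) u - u‖ := by
    intro s t hs hst
    have : V t u = V s (V (t - s) u) := by
      conv_lhs => rw [← add_sub_cancel s t, h.sum_add hV hs (sub_nonneg.2 hst)]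
      rfl
    rw [this, ← map_sub]
    exact (V s).le_of_opNorm_le (hb s hs) _
  have habs : ∀ t, 0 ≤ t → ‖V t u - V s u‖ ≤ K * ‖V |t - s| u - u‖ := by
    intro t ht
    rcases le_total s t with hst | hst
    · rw [abs_of_nonneg (sub_nonneg.2 hst)]
      exact hle s t hs hst
    · rw [abs_sub_comm, abs_of_nonneg (sub_nonneg.2 hst), norm_sub_rev]
      exact hle t s ht hst
  have hlim : Tendsto (fun t => |t - s|) (𝓝[Ici 0] s) (𝓝[≥] 0) := by
    refine tendsto_nhdsWithin_iff.2 ⟨?_, Eventually.of_forall fun t => mem_Ici.2 (abs_nonneg _)⟩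
    have : Continuous fun t => |t - s| := by fun_prop
    simpa using (this.tendsto s).mono_left nhdsWithin_le_nhds
  refine tendsto_iff_norm_sub_tendsto_zero.2 ?_
  refine squeeze_zero_norm' (a := fun t => K * ‖V |t - s| u - u‖) ?_ ?_
  · filter_upwards [self_mem_nhdsWithin] with t ht
    rw [norm_norm]
    exact habs t ht
  · simpa using ((tendsto_iff_norm_sub_tendsto_zero.1
      ((h.tendsto_sum_zero hV u).comp hlim)).const_mul K)

/-! ### The generator of the sum, and minimality -/

theorem sum_duhamel (h : IsKatoPerturbation U B)
    (hV : ∀ t, 0 ≤ t → ∀ u, HasSum (fun n => dysonPhillips U B n t u) (V t u))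
    {t : ℝ} (ht : 0 ≤ t) {u : X} (hu : u ∈ (generator U).domain) :
    V t u = U t u + ∫ s in (0 : ℝ)..t, duhamelIntegrand U B V t u s := by
  obtain ⟨K, hK0, hK⟩ := exists_opNorm_le_of_le_on_cone X
  have hP : ∀ (n : ℕ) (t : ℝ), 0 ≤ t →
      ‖∑ k ∈ Finset.range n, dysonPhillips U B k t‖ ≤ K := fun n t ht => hK _ fun u hu => by
    simpa only [sum_apply] using h.norm_sum_dysonPhillips_le n ht hu
  have hint : Tendsto (fun n => ∫ s in (0 : ℝ)..t,
      ∑ k ∈ Finset.range n, duhamelIntegrand U B (dysonPhillips U B k) t u s) atTop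
      (𝓝 (∫ s in (0 : ℝ)..t, duhamelIntegrand U B V t u s)) := by
    refine intervalIntegral.tendsto_integral_filter_of_dominated_convergence
      (fun s => K * ‖onDomain B (U s u)‖) (Eventually.of_forall fun n => ?_)
      (Eventually.of_forall fun n => ae_of_all _ fun s hs => ?_)
      ((h.intervalIntegrable_norm hu ht).const_mul K) (ae_of_all _ fun s hs => ?_)
    · rw [uIoc_of_le ht]
      refine ContinuousOn.aestronglyMeasurable ?_ measurableSet_Ioc
      exact continuousOn_finsetSum _ fun k _ => (h.continuousOn_duhamelIntegrand
        (h.isPosBoundedStronglyContinuous_dysonPhillips k) t hu).mono Ioc_subset_Icc_self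
    · rw [uIoc_of_le ht] at hs
      have := (∑ k ∈ Finset.range n, dysonPhillips U B k (t - s)).le_of_opNorm_le
        (hP n _ (sub_nonneg.2 hs.2)) (onDomain B (U s u))
      simpa only [sum_apply, duhamelIntegrand] using this
    · rw [uIoc_of_le ht] at hs
      exact (hV _ (sub_nonneg.2 hs.2) _).tendsto_sum_nat
  refine tendsto_nhds_unique ((hV t ht u).tendsto_sum_nat.comp (tendsto_add_atTop_nat 1)) ?_
  refine (hint.const_add (U t u)).congr fun n => ?_
  exact (h.sum_dysonPhillips_succ_apply n ht hu).symm

theorem perturbed_le_generator_sum (h : IsKatoPerturbation U B)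
    (hV : ∀ t, 0 ≤ t → ∀ u, HasSum (fun n => dysonPhillips U B n t u) (V t u)) :
    perturbed (generator U) B ≤ generator V := by
  have hVs := h.isSubstochastic_sum hV
  obtain ⟨C, hC⟩ := hVs.exists_bound
  have hslope : ∀ u : (generator U).domain,
      Tendsto (fun t : ℝ => t⁻¹ • (V t u - u)) (𝓝[>] 0) (𝓝 (generator U u + B u)) := by
    intro u
    have hint : Tendsto (fun t : ℝ => t⁻¹ • ∫ s in (0 : ℝ)..t, duhamelIntegrand U B V t u s)
        (𝓝[>] 0) (𝓝 (B u)) := by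
      -- the integrand is jointly continuous in `(t, s)` on `0 ≤ s ≤ t`, with value `B u` at `(0, 0)`
      have hb0 : onDomain B (U 0 (u : X)) = B u := by
        rw [h.apply_zero, onDomain_of_mem B u.2]
      have hb := h.continuousOn_onDomain u.2
      have hVu : ContinuousOn (fun p : ℝ × ℝ => V (p.1 - p.2) (onDomain B (U p.2 (u : X))))
          {p | 0 ≤ p.2 ∧ p.2 ≤ p.1} := by
        refine continuousOn_apply_of_bounded (S := fun p : ℝ × ℝ => V (p.1 - p.2)) (C := C)
          (fun p hp => hC _ (sub_nonneg.2 hp.2)) (fun v => ?_)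
          (hb.comp (f := fun p : ℝ × ℝ => p.2) (by fun_prop) fun p hp => hp.1)
        exact (hVs.continuousOn v).comp (by fun_prop) fun p hp => sub_nonneg.2 hp.2
      rw [Metric.tendsto_nhdsWithin_nhds]
      intro ε hε
      obtain ⟨δ, hδ, hδε⟩ := Metric.continuousOn_iff.1 hVu (0, 0) ⟨le_rfl, le_rfl⟩ (ε / 2)
        (by positivity)
      refine ⟨δ, hδ, fun t ht htδ => ?_⟩
      have ht0 : (0 : ℝ) < t := ht
      rw [Real.dist_eq, sub_zero, abs_of_pos ht0] at htδ
      have hpt : ∀ s ∈ uIoc 0 t, ‖duhamelIntegrand U B V t u s - B u‖ ≤ ε / 2 := by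
        intro s hs
        rw [uIoc_of_le ht0.le] at hs
        have := hδε (t, s) ⟨hs.1.le, hs.2⟩ (by
          rw [Prod.dist_eq, Real.dist_eq, Real.dist_eq, sub_zero, sub_zero, abs_of_pos ht0,
            abs_of_pos hs.1]
          exact max_lt htδ (hs.2.trans_lt htδ))
        rw [dist_eq_norm] at this
        simp only [sub_zero, hVs.apply_zero, hb0] at this
        exact this.le
      have hI := intervalIntegral.norm_integral_le_of_norm_le_const hpt
      rw [intervalIntegral.integral_sub (h.intervalIntegrable_duhamelIntegrand
        hVs.isPosBoundedStronglyContinuous ht0.le u.2) intervalIntegrable_const,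
        intervalIntegral.integral_const, sub_zero, abs_of_pos ht0] at hI
      have e : t⁻¹ • (∫ s in (0 : ℝ)..t, duhamelIntegrand U B V t u s) - B u =
          t⁻¹ • ((∫ s in (0 : ℝ)..t, duhamelIntegrand U B V t u s) - t • B u) := by
        rw [smul_sub, smul_smul, inv_mul_cancel₀ ht0.ne', one_smul]
      rw [dist_eq_norm, e, norm_smul, norm_inv, Real.norm_of_nonneg ht0.le]
      calc t⁻¹ * _ ≤ t⁻¹ * (ε / 2 * t) := mul_le_mul_of_nonneg_left hI (by positivity)
        _ = ε / 2 := by field_simp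
        _ < ε := by linarith
    refine ((tendsto_generator U u).add hint).congr' ?_
    filter_upwards [self_mem_nhdsWithin] with t ht
    rw [h.sum_duhamel hV (le_of_lt ht) u.2, ← smul_add]
    congr 1
    abel
  refine ⟨fun u hu => (generator_eq_of_tendsto (hslope ⟨u, hu⟩)).1, fun x y hxy => ?_⟩
  obtain ⟨h1, h2⟩ := generator_eq_of_tendsto (hslope x)
  have : y = ⟨(x : X), h1⟩ := Subtype.ext hxy.symm
  rw [this, h2]
  rfl

end Sum

/-- Any substochastic semigroup whose generator extends `A + B` satisfies the Duhamel formula: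
`s ↦ S(t - s) U(s) u` has right derivative `-S(t - s) B U(s) u`. -/
theorem duhamel_of_extends (h : IsKatoPerturbation U B) {S : ℝ → X →L[ℝ] X}
    (hS : IsSubstochastic S) (hext : perturbed (generator U) B ≤ generator S) {t : ℝ}
    (ht : 0 ≤ t) {u : X} (hu : u ∈ (generator U).domain) :
    S t u = U t u + ∫ s in (0 : ℝ)..t, duhamelIntegrand U B S t u s := by
  have hSp := hS.isPosBoundedStronglyContinuous
  obtain ⟨C, hC⟩ := hSp.bounded
  have hslope : ∀ x : (generator U).domain,
      Tendsto (fun r : ℝ => r⁻¹ • (U r x - S r x)) (𝓝[>] 0) (𝓝 (-B x)) := by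
    intro x
    have hx : (x : X) ∈ (generator S).domain := hext.1 x.2
    have e : generator S ⟨x, hx⟩ = generator U x + B x :=
      (hext.2 (x := (x : (perturbed (generator U) B).domain)) (y := ⟨x, hx⟩) rfl).symm
    have h1 := (tendsto_generator U x).sub (tendsto_generator S ⟨x, hx⟩)
    rw [e, sub_add_cancel_left] at h1
    refine h1.congr fun r => ?_
    rw [← smul_sub, sub_sub_sub_cancel_right]
  have hcont : ContinuousOn (fun s => S (t - s) (U s u)) (Icc 0 t) := by
    refine continuousOn_apply_of_bounded (S := fun s => S (t - s)) (C := C)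
      (fun s hs => hC _ (sub_nonneg.2 hs.2)) (fun v => ?_)
      ((h.continuousOn u).mono Icc_subset_Ici_self)
    exact (hS.continuousOn v).comp (by fun_prop) fun s hs => sub_nonneg.2 hs.2
  have hftc := intervalIntegral.integral_eq_sub_of_hasDeriv_right (a := 0) (b := t)
    (f := fun s => S (t - s) (U s u)) (f' := fun s => -duhamelIntegrand U B S t u s)
    (by rwa [uIcc_of_le ht]) (fun s hs => by
      rw [min_eq_left ht, max_eq_right ht] at hs
      refine hasDerivWithinAt_Ioi_of_tendsto ?_
      have hx := h.mem_domain hu hs.1.le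
      have hts : 0 < t - s := sub_pos.2 hs.2
      have hSt : Tendsto (fun r => S (t - (s + r)) (-B ⟨U s u, hx⟩)) (𝓝[>] 0)
          (𝓝 (S (t - s) (-B ⟨U s u, hx⟩))) := by
        have h1 : ContinuousAt (fun r => S r (-B ⟨U s u, hx⟩)) (t - s) :=
          (hS.continuousOn _).continuousAt (Ici_mem_nhds hts)
        have h2 : Tendsto (fun r => t - (s + r)) (𝓝[>] 0) (𝓝 (t - s)) := by
          have : Continuous fun r => t - (s + r) := by fun_prop
          simpa using (this.tendsto 0).mono_left nhdsWithin_le_nhds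
        exact h1.tendsto.comp h2
      have hev : ∀ᶠ r in 𝓝[>] (0 : ℝ), 0 ≤ t - (s + r) := by
        filter_upwards [Ioo_mem_nhdsGT hts] with r hr
        linarith [hr.2]
      have h3 := tendsto_apply_of_bounded (hev.mono fun r hr => hC _ hr) (hslope ⟨U s u, hx⟩) hSt
      have e : -duhamelIntegrand U B S t u s = S (t - s) (-B ⟨U s u, hx⟩) := by
        rw [duhamelIntegrand, onDomain_of_mem B hx, map_neg]
      rw [e]
      refine h3.congr' ?_
      filter_upwards [hev, self_mem_nhdsWithin] with r hr hr0
      have hr0' : (0 : ℝ) ≤ r := le_of_lt hr0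
      rw [map_smul, map_sub, ← h.apply_add hr0' hs.1.le, ← hS.apply_add hr hr0']
      rw [add_comm r s, sub_add_eq_sub_sub, sub_add_cancel])
    (h.intervalIntegrable_duhamelIntegrand hSp ht hu).neg
  simp only [intervalIntegral.integral_neg, sub_self, sub_zero, hS.apply_zero, h.apply_zero]
    at hftc
  rw [← neg_sub, neg_inj] at hftc
  rw [hftc]
  abel

theorem sum_dysonPhillips_le_of_extends (h : IsKatoPerturbation U B) {S : ℝ → X →L[ℝ] X}
    (hS : IsSubstochastic S) (hext : perturbed (generator U) B ≤ generator S) (n : ℕ) :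
    ∀ {t : ℝ}, 0 ≤ t → ∀ {u : X}, 0 ≤ u →
      ∑ k ∈ Finset.range n, dysonPhillips U B k t u ≤ S t u := by
  induction n with
  | zero => intro t ht u hu; simpa using hS.nonneg t ht u hu
  | succ n ih =>
    intro t ht u hu0
    have hc : Continuous fun u => ∑ k ∈ Finset.range (n + 1), dysonPhillips U B k t u := by
      fun_prop
    refine h.induction_nonneg (isClosed_le hc (S t).continuous) (fun u hu hu0 => ?_) hu0
    rw [h.sum_dysonPhillips_succ_apply n ht hu, h.duhamel_of_extends hS hext ht hu]
    refine add_le_add_right ?_ _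
    rw [← sub_nonneg, ← intervalIntegral.integral_sub
      (h.intervalIntegrable_duhamelIntegrand hS.isPosBoundedStronglyContinuous ht hu)]
    · exact intervalIntegral_nonneg ht fun s hs => sub_nonneg.2 <|
        ih (sub_nonneg.2 hs.2) (h.onDomain_nonneg hu hu0 hs.1)
    · refine ContinuousOn.intervalIntegrable ?_
      rw [uIcc_of_le ht]
      exact continuousOn_finsetSum _ fun k _ => h.continuousOn_duhamelIntegrand
        (h.isPosBoundedStronglyContinuous_dysonPhillips k) t hu

theorem isMinimalSemigroup_sum (h : IsKatoPerturbation U B) {V : ℝ → X →L[ℝ] X}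
    (hV : ∀ t, 0 ≤ t → ∀ u, HasSum (fun n => dysonPhillips U B n t u) (V t u)) :
    IsMinimalSemigroup U B V :=
  ⟨h.isSubstochastic_sum hV, h.perturbed_le_generator_sum hV, fun _ hS hext t ht u hu =>
    le_of_tendsto (hV t ht u).tendsto_sum_nat <| Eventually.of_forall fun n =>
      h.sum_dysonPhillips_le_of_extends hS hext n ht hu⟩

theorem hasSum_of_isMinimalSemigroup (h : IsKatoPerturbation U B) {V : ℝ → X →L[ℝ] X}
    (hV : IsMinimalSemigroup U B V) {t : ℝ} (ht : 0 ≤ t) (u : X) :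
    HasSum (fun n => dysonPhillips U B n t u) (V t u) := by
  obtain ⟨W, hW⟩ := exists_hasSum_dysonPhillips U B h
  have hWm := h.isMinimalSemigroup_sum hW
  have heq : ∀ v : X, 0 ≤ v → V t v = W t v := fun v hv => le_antisymm
    (hV.le_of_extends W hWm.toIsSubstochastic hWm.extends_perturbed t ht v hv)
    (hWm.le_of_extends V hV.toIsSubstochastic hV.extends_perturbed t ht v hv)
  have : V t u = W t u := by
    obtain ⟨v, w, hv, hw, rfl⟩ := generating u
    rw [map_sub, map_sub, heq v hv, heq w hw]
  rw [this]
  exact hW t ht u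

end IsKatoPerturbation

end AbstractStateSpace

open AbstractStateSpace in
theorem theorem2p3 {X : Type*} [NormedAddCommGroup X] [NormedSpace ℝ X] [CompleteSpace X]
    [PartialOrder X] [AbstractStateSpace X]
    (U : ℝ → X →L[ℝ] X) (hU : IsSubstochastic U)
    (B : (generator U).domain →ₗ[ℝ] X)
    (hB : ∀ u : (generator U).domain, 0 ≤ (u : X) → 0 ≤ B u)
    (hAB : ∀ u : (generator U).domain, 0 ≤ (u : X) → psi X (generator U u + B u) ≤ 0) :
    -- the minimal semigroup exists
    (∃ V : ℝ → X →L[ℝ] X, IsMinimalSemigroup U B V) ∧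
    -- the iterates are well defined: `L^{n+1}(U)(t)` is the unique bounded extension of the
    -- integral operator with kernel `L^n(U)`, and it is positive
    (∀ n : ℕ, IsPosBoundedStronglyContinuous (dysonPhillips U B n)) ∧
    (∀ (n : ℕ) (t : ℝ), 0 ≤ t →
      (∀ u ∈ (generator U).domain, IntervalIntegrable
        (duhamelIntegrand U B (dysonPhillips U B n) t u) MeasureTheory.volume 0 t) ∧
      (∀ T : X →L[ℝ] X,
        (∀ u ∈ (generator U).domain,
          T u = ∫ s in (0 : ℝ)..t, duhamelIntegrand U B (dysonPhillips U B n) t u s) ↔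
        T = dysonPhillips U B (n + 1) t)) ∧
    -- Duhamel formula and Dyson-Phillips expansion of the minimal semigroup
    (∀ V : ℝ → X →L[ℝ] X, IsMinimalSemigroup U B V → ∀ t : ℝ, 0 ≤ t →
      (∀ u ∈ (generator U).domain,
        IntervalIntegrable (duhamelIntegrand U B V t u) MeasureTheory.volume 0 t ∧
        V t u = U t u + ∫ s in (0 : ℝ)..t, duhamelIntegrand U B V t u s) ∧
      (∀ u : X, HasSum (fun n : ℕ => dysonPhillips U B n t u) (V t u))) := by
  have h : IsKatoPerturbation U B := ⟨hU, hB, hAB⟩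
  have hn := h.isPosBoundedStronglyContinuous_dysonPhillips
  refine ⟨?_, hn, fun n t ht => ⟨fun u hu => h.intervalIntegrable_duhamelIntegrand (hn n) ht hu,
    fun T => ⟨fun hT => ?_, ?_⟩⟩, fun V hV t ht => ⟨fun u hu => ⟨?_, ?_⟩,
    fun u => h.hasSum_of_isMinimalSemigroup hV ht u⟩⟩
  · obtain ⟨V, hV⟩ := IsKatoPerturbation.exists_hasSum_dysonPhillips U B h
    exact ⟨V, h.isMinimalSemigroup_sum hV⟩
  · exact h.eq_of_eqOn_domain fun u hu =>
      (hT u hu).trans (h.dysonPhillips_succ_apply n ht hu).symm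
  · rintro rfl u hu
    exact h.dysonPhillips_succ_apply n ht hu
  · exact h.intervalIntegrable_duhamelIntegrand
      hV.toIsSubstochastic.isPosBoundedStronglyContinuous ht hu
  · exact h.duhamel_of_extends hV.toIsSubstochastic hV.extends_perturbed ht hu
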